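/- Let $n\ge 1$ and let $\mathfrak h_{(n)}=\{X+iY: X,Y \text{ real symmetric } n\times n,\ Y>0\}$ be Siegel's upper half-space, on which $Sp_n(\mathbb Z)$ acts by $\gamma\tau=(A\tau+B)(C\tau+D)^{-1}$ for $\gamma=\begin{pmatrix}A&B\\C&D\end{pmatrix}$. An automorphy factor for $\gamma$ is an analytic function $\varphi$ on $\mathfrak h_{(n)}$ with $|\varphi(\tau)|^2=|\det(C\tau+D)|$ for all $\tau$. Pairs are multiplied by $[\gamma,\varphi][\gamma',\varphi']=[\gamma\gamma',\varphi(\gamma'\tau)\varphi'(\tau)]$. Let $$\theta(\tau)=\sum_{U\in\mathbb Z^{1,n}}\exp\bigl(\pi i\,\mathrm{Tr}(2\,{}^tU U\tau)\bigr),\qquad \Gamma_0(4)=\left\{\begin{pmatrix}A&B\\C&D\end{pmatrix}\in Sp_n(\mathbb Z):\ 4\mid C\right\},$$ $$\widetilde\Gamma_0(4)=\{[\gamma,\theta(\gamma\tau)/\theta(\tau)]:\ \gamma\in\Gamma_0(4)\},$$ where $\theta(\gamma\tau)/\theta(\tau)$ denotes the automorphy factor $\varphi$ for $\gamma$ with $\theta(\gamma\tau)=\varphi(\tau)\theta(\tau)$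 for all $\tau\in\mathfrak h_{(n)}$. Let $\Gamma$ be a subgroup of $Sp_n(\mathbb Z)$ containing $\Gamma_0(4)$, and let $\widetilde\Gamma$ be a cover of $\Gamma$, meaning a group (under the product above) whose elements are of the form $[\gamma,\varphi]$ with $\gamma\in\Gamma$ and $\varphi$ an automorphy factor for $\gamma$. It is a one-fold cover of $\Gamma$ if for every $\gamma\in\Gamma$ there is exactly one element of $\widetilde\Gamma$ of the form $[\gamma,\varphi]$. Suppose that $\widetilde\Gamma_0(4)\subseteq\widetilde\Gamma$, and that $\begin{pmatrix}I&0\\M&I\end{pmatrix}\in\Gamma$ for some integral matrix $M$ such that either (i) $M\equiv I_d\perp 2I_{d'}\perp\langle 0\rangle^{n-d-d'}\pmod 4$ for some $d,d'\ge 0$ with $d+d'\le n$ and $d+d'>0$, or (ii) $M\equiv I_d\perp\begin{pmatrix}0&2\\2&0\end{pmatrix}^{d'/2}\perp\langle 0\rangle^{n-d-d'}\pmod 4$ for some $d>0$ and some even $d'\ge 0$ with $d+d'\le n$. Here $A\perp B$ denotes the block diagonal matrix $\mathrm{diag}\{A,B\}$, $\begin{pmatrix}0&2\\2&0\end{pmatrix}^{e}$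 is the block diagonal matrix with $e$ such blocks, and $\langle 0\rangle^{m}$ is the $m\times m$ zero matrix. Then $\widetilde\Gamma$ is not a one-fold cover of $\Gamma$. In particular, for $n=1$ there is no group $\Gamma$ with $\Gamma_0(4)\subsetneq\Gamma\subseteq SL_2(\mathbb Z)$ that has a one-fold cover $\widetilde\Gamma$ with $\widetilde\Gamma_0(4)\subseteq\widetilde\Gamma$. -/

import Mathlib

open Matrix

open scoped MatrixGroups

noncomputable section

namespace SiegelTheta

-- The entrywise sup norm; analyticity on a finite-dimensional space does not depend on this choice.
attribute [local instance] Matrix.normedAddCommGroup Matrix.normedSpace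

/-- The integral symplectic group of degree `n`: the integral `2n × 2n` matrices `γ` with
`γ J γᵀ = J`. -/
abbrev Sp (n : ℕ) : Type := symplecticGroup (Fin n) ℤ

/-- The complex vector space of symmetric complex `n × n` matrices. -/
def symMat (n : ℕ) : Submodule ℂ (Matrix (Fin n) (Fin n) ℂ) where
  carrier := {Z | Zᵀ = Z}
  add_mem' := by
    intro a b ha hb
    simp only [Set.mem_ofPred_eq] at ha hb ⊢
    rw [transpose_add, ha, hb]
  zero_mem' := by simp
  smul_mem' := by
    intro c a ha
    simp only [Set.mem_ofPred_eq] at ha ⊢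
    rw [transpose_smul, ha]

/-- Siegel's upper half-space of degree `n`: the symmetric complex matrices `X + iY` whose
imaginary part `Y` is positive definite. -/
def siegelSpace (n : ℕ) : Set (symMat n) :=
  {Z | ((Z : Matrix (Fin n) (Fin n) ℂ).map Complex.im).PosDef}

variable {n : ℕ}

/-- The underlying complex matrix of a point of the Siegel upper half-space. -/
def mat (τ : siegelSpace n) : Matrix (Fin n) (Fin n) ℂ := τ.1.1

/-- The blocks of `γ = (A B; C D)`, viewed as complex matrices. -/
def blkA (γ : Sp n) : Matrix (Fin n) (Fin n) ℂ := γ.1.toBlocks₁₁.map (Int.cast : ℤ → ℂ)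

/-- The upper right block `B`. -/
def blkB (γ : Sp n) : Matrix (Fin n) (Fin n) ℂ := γ.1.toBlocks₁₂.map (Int.cast : ℤ → ℂ)

/-- The lower left block `C`. -/
def blkC (γ : Sp n) : Matrix (Fin n) (Fin n) ℂ := γ.1.toBlocks₂₁.map (Int.cast : ℤ → ℂ)

/-- The lower right block `D`. -/
def blkD (γ : Sp n) : Matrix (Fin n) (Fin n) ℂ := γ.1.toBlocks₂₂.map (Int.cast : ℤ → ℂ)

/-- `A τ + B`. -/
def numer (γ : Sp n) (τ : siegelSpace n) : Matrix (Fin n) (Fin n) ℂ :=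
  blkA γ * mat τ + blkB γ

/-- `C τ + D`. -/
def denom (γ : Sp n) (τ : siegelSpace n) : Matrix (Fin n) (Fin n) ℂ :=
  blkC γ * mat τ + blkD γ

theorem mat_transpose (τ : siegelSpace n) : (mat τ)ᵀ = mat τ := τ.1.2

/-- `γ`, as a complex matrix, in block form. -/
theorem map_eq_blocks (γ : Sp n) : γ.1.map (Int.cast : ℤ → ℂ) =
    fromBlocks (blkA γ) (blkB γ) (blkC γ) (blkD γ) := by
  ext i j
  rcases i with i | i <;> rcases j with j | j <;> rfl

theorem blocks_rel (γ : Sp n) :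
    (blkA γ)ᵀ * blkC γ = (blkC γ)ᵀ * blkA γ ∧
    (blkB γ)ᵀ * blkD γ = (blkD γ)ᵀ * blkB γ ∧
    (blkA γ)ᵀ * blkD γ - (blkC γ)ᵀ * blkB γ = 1 := by
  have h := SymplecticGroup.map_mem γ.2 (Int.castRingHom ℂ)
  change γ.1.map (Int.cast : ℤ → ℂ) ∈ symplecticGroup (Fin n) ℂ at h
  rw [map_eq_blocks γ, SymplecticGroup.fromBlocks_mem_iff] at h
  exact h

open scoped ComplexOrder in
/-- A real matrix is positive definite if and only if it is so as a complex matrix. -/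
theorem posDef_ofReal_iff {Y : Matrix (Fin n) (Fin n) ℝ} :
    (Y.map (Complex.ofReal : ℝ → ℂ)).PosDef ↔ Y.PosDef := by
  have hherm : (Y.map (Complex.ofReal : ℝ → ℂ)).IsHermitian ↔ Y.IsHermitian := by
    constructor
    · intro h
      ext i j
      have := congrFun (congrFun h i) j
      simpa using this
    · intro h
      ext i j
      have := congrFun (congrFun h i) j
      simp only [conjTranspose_apply, star_trivial] at this
      simp [this]
  rw [posDef_iff_dotProduct_mulVec, posDef_iff_dotProduct_mulVec, hherm]
  constructor
  · rintro ⟨h, hp⟩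
    refine ⟨h, fun x hx => ?_⟩
    have hx' : (fun i => (x i : ℂ)) ≠ 0 := by
      intro h0
      apply hx
      ext i
      simpa using congrFun h0 i
    have h1 := hp hx'
    have h2 : star (fun i => (x i : ℂ)) ⬝ᵥ (Y.map (Complex.ofReal : ℝ → ℂ) *ᵥ fun i => (x i : ℂ)) =
        ((star x ⬝ᵥ (Y *ᵥ x) : ℝ) : ℂ) := by
      simp [dotProduct, mulVec]
    rw [h2] at h1
    exact_mod_cast h1
  · rintro ⟨h, hp⟩
    refine ⟨h, fun x hx => ?_⟩
    set a : Fin n → ℝ := fun i => (x i).re with ha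
    set b : Fin n → ℝ := fun i => (x i).im with hb
    have hxe : x = fun i => (a i : ℂ) + b i * Complex.I := by
      ext i
      exact (Complex.re_add_im (x i)).symm
    have hsymm : ∀ i j, Y j i = Y i j := fun i j => by
      have := congrFun (congrFun h i) j
      simpa using this
    have hcross : ∑ i, ∑ j, a i * (Y i j * b j) = ∑ i, ∑ j, b i * (Y i j * a j) := by
      rw [Finset.sum_comm]
      refine Finset.sum_congr rfl fun i _ => Finset.sum_congr rfl fun j _ => ?_
      rw [hsymm i j]
      ring
    have hcross' : ∑ i, ∑ j, (a i : ℂ) * (Y i j * b j) = ∑ i, ∑ j, (b i : ℂ) * (Y i j * a j) := by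
      exact_mod_cast congrArg (Complex.ofReal) hcross
    have key : star x ⬝ᵥ (Y.map (Complex.ofReal : ℝ → ℂ) *ᵥ x) =
        ((star a ⬝ᵥ (Y *ᵥ a) + star b ⬝ᵥ (Y *ᵥ b) : ℝ) : ℂ) := by
      have e1 : star x ⬝ᵥ (Y.map (Complex.ofReal : ℝ → ℂ) *ᵥ x) =
          ∑ i, ∑ j, ((a i : ℂ) * (Y i j * a j) + (b i : ℂ) * (Y i j * b j)
            + Complex.I * ((a i : ℂ) * (Y i j * b j) - (b i : ℂ) * (Y i j * a j))) := by
        rw [hxe]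
        simp only [dotProduct, mulVec, Finset.mul_sum, Pi.star_apply, Matrix.map_apply]
        refine Finset.sum_congr rfl fun i _ => Finset.sum_congr rfl fun j _ => ?_
        simp only [star_add, star_mul', Complex.star_def, Complex.conj_ofReal, Complex.conj_I]
        linear_combination (-(b i : ℂ) * Y i j * b j) * Complex.I_sq
      rw [e1]
      simp only [Finset.sum_add_distrib, ← Finset.mul_sum, Finset.sum_sub_distrib]
      simp [dotProduct, mulVec, Finset.mul_sum]
      rw [sub_eq_zero]
      exact hcross'
    rw [key]
    have hnn : ∀ y : Fin n → ℝ, 0 ≤ star y ⬝ᵥ (Y *ᵥ y) := fun y => by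
      by_cases hy : y = 0
      · simp [hy]
      · exact (hp hy).le
    have : a ≠ 0 ∨ b ≠ 0 := by
      by_contra hcon
      push Not at hcon
      apply hx
      rw [hxe]
      ext i
      simp [hcon.1, hcon.2]
    have hpos : 0 < star a ⬝ᵥ (Y *ᵥ a) + star b ⬝ᵥ (Y *ᵥ b) := by
      rcases this with h1 | h1
      · exact add_pos_of_pos_of_nonneg (hp h1) (hnn b)
      · exact add_pos_of_nonneg_of_pos (hnn a) (hp h1)
    exact_mod_cast hpos

/-- For symmetric `Z`, one has `Z - Zᴴ = 2 i Im Z`. -/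
theorem sub_conjTranspose {Z : Matrix (Fin n) (Fin n) ℂ} (hZ : Zᵀ = Z) :
    Z - Zᴴ = (2 * Complex.I) • (Z.map Complex.im).map (Complex.ofReal : ℝ → ℂ) := by
  ext i j
  have h : Z j i = Z i j := congrFun (congrFun hZ i) j
  simp only [Matrix.sub_apply, Matrix.map_apply, Matrix.smul_apply, smul_eq_mul,
    conjTranspose_apply, h, Complex.star_def]
  rw [Complex.sub_conj]
  push_cast
  ring

theorem denom_numer_symm (γ : Sp n) (τ : siegelSpace n) :
    (numer γ τ)ᵀ * denom γ τ = (denom γ τ)ᵀ * numer γ τ := by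
  obtain ⟨h1, h2, h3⟩ := blocks_rel γ
  have h4 : (blkD γ)ᵀ * blkA γ - (blkB γ)ᵀ * blkC γ = 1 := by
    have := congrArg transpose h3
    simpa using this
  rw [← sub_eq_zero]
  have : (numer γ τ)ᵀ * denom γ τ - (denom γ τ)ᵀ * numer γ τ =
      mat τ * ((blkA γ)ᵀ * blkC γ - (blkC γ)ᵀ * blkA γ) * mat τ
      + mat τ * ((blkA γ)ᵀ * blkD γ - (blkC γ)ᵀ * blkB γ)
      - ((blkD γ)ᵀ * blkA γ - (blkB γ)ᵀ * blkC γ) * mat τ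
      + ((blkB γ)ᵀ * blkD γ - (blkD γ)ᵀ * blkB γ) := by
    simp only [numer, denom, transpose_add, transpose_mul, mat_transpose]
    noncomm_ring
  rw [this, h1, h2, h3, h4]
  simp

theorem blk_conjTranspose {M : Matrix (Fin n) (Fin n) ℤ} :
    (M.map (Int.cast : ℤ → ℂ))ᴴ = (M.map (Int.cast : ℤ → ℂ))ᵀ := by
  ext i j
  simp

theorem denom_numer_im (γ : Sp n) (τ : siegelSpace n) :
    (denom γ τ)ᴴ * numer γ τ - (numer γ τ)ᴴ * denom γ τ = mat τ - (mat τ)ᴴ := by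
  obtain ⟨h1, h2, h3⟩ := blocks_rel γ
  have h4 : (blkD γ)ᵀ * blkA γ - (blkB γ)ᵀ * blkC γ = 1 := by
    have := congrArg transpose h3
    simpa using this
  have eA : (blkA γ)ᴴ = (blkA γ)ᵀ := blk_conjTranspose
  have eB : (blkB γ)ᴴ = (blkB γ)ᵀ := blk_conjTranspose
  have eC : (blkC γ)ᴴ = (blkC γ)ᵀ := blk_conjTranspose
  have eD : (blkD γ)ᴴ = (blkD γ)ᵀ := blk_conjTranspose
  have : (denom γ τ)ᴴ * numer γ τ - (numer γ τ)ᴴ * denom γ τ =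
      (mat τ)ᴴ * ((blkC γ)ᵀ * blkA γ - (blkA γ)ᵀ * blkC γ) * mat τ
      - (mat τ)ᴴ * ((blkA γ)ᵀ * blkD γ - (blkC γ)ᵀ * blkB γ)
      + ((blkD γ)ᵀ * blkA γ - (blkB γ)ᵀ * blkC γ) * mat τ
      - ((blkB γ)ᵀ * blkD γ - (blkD γ)ᵀ * blkB γ) := by
    simp only [numer, denom, conjTranspose_add, conjTranspose_mul, eA, eB, eC, eD]
    noncomm_ring
  rw [this, h1, h2, h3, h4]
  simp only [sub_self, mul_zero, zero_mul, mul_one, one_mul, sub_zero]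
  abel

open scoped ComplexOrder in
/-- `C τ + D` is invertible. -/
theorem isUnit_denom (γ : Sp n) (τ : siegelSpace n) : IsUnit (denom γ τ) := by
  rw [isUnit_iff_isUnit_det, isUnit_iff_ne_zero]
  intro h0
  obtain ⟨v, hv, hv0⟩ := exists_mulVec_eq_zero_iff.mpr h0
  have hpos := (posDef_ofReal_iff.mpr τ.2).dotProduct_mulVec_pos hv
  have hq := congrArg (fun X => star v ⬝ᵥ (X *ᵥ v)) (denom_numer_im γ τ)
  have hs : mat τ - (mat τ)ᴴ = _ := sub_conjTranspose (mat_transpose τ)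
  simp only [hs] at hq
  have hl : star v ⬝ᵥ (((denom γ τ)ᴴ * numer γ τ - (numer γ τ)ᴴ * denom γ τ) *ᵥ v) = 0 := by
    have e1 : star v ᵥ* (denom γ τ)ᴴ = 0 := by
      rw [← star_mulVec, hv0, star_zero]
    rw [sub_mulVec, dotProduct_sub, ← mulVec_mulVec, ← mulVec_mulVec, hv0,
      dotProduct_mulVec (star v) (denom γ τ)ᴴ, e1]
    simp
  rw [hl, smul_mulVec, dotProduct_smul, smul_eq_mul] at hq
  rcases mul_eq_zero.mp hq.symm with h | h
  · simp at h
  · exact hpos.ne' h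

theorem isUnit_det_denom (γ : Sp n) (τ : siegelSpace n) : IsUnit (denom γ τ).det :=
  (isUnit_iff_isUnit_det _).mp (isUnit_denom γ τ)

/-- The transform `(A τ + B) (C τ + D)⁻¹`, as a complex matrix. -/
def moeb (γ : Sp n) (τ : siegelSpace n) : Matrix (Fin n) (Fin n) ℂ :=
  numer γ τ * (denom γ τ)⁻¹

theorem moeb_mul_denom (γ : Sp n) (τ : siegelSpace n) :
    moeb γ τ * denom γ τ = numer γ τ := by
  rw [moeb, mul_assoc, nonsing_inv_mul _ (isUnit_det_denom γ τ), mul_one]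

theorem moeb_transpose (γ : Sp n) (τ : siegelSpace n) : (moeb γ τ)ᵀ = moeb γ τ := by
  have hu := isUnit_denom γ τ
  have hut : IsUnit (denom γ τ)ᵀ := by
    rw [isUnit_iff_isUnit_det, det_transpose]
    exact isUnit_det_denom γ τ
  apply hu.mul_right_cancel
  apply hut.mul_left_cancel
  rw [moeb_mul_denom, ← denom_numer_symm, ← mul_assoc, ← transpose_mul, moeb_mul_denom]

open scoped ComplexOrder in
theorem moeb_im_posDef (γ : Sp n) (τ : siegelSpace n) :
    ((moeb γ τ).map Complex.im).PosDef := by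
  have hu := isUnit_denom γ τ
  have hdet := isUnit_det_denom γ τ
  have hut : IsUnit (denom γ τ)ᴴ := by
    rw [isUnit_iff_isUnit_det, det_conjTranspose]
    exact hdet.star
  rw [← posDef_ofReal_iff, ← Matrix.IsUnit.posDef_star_left_conjugate_iff hu]
  have h2 : (2 * Complex.I : ℂ) ≠ 0 := by simp
  have h1 := sub_conjTranspose (moeb_transpose γ τ)
  have h3 : (denom γ τ)ᴴ * (moeb γ τ - (moeb γ τ)ᴴ) * denom γ τ = mat τ - (mat τ)ᴴ := by
    rw [← denom_numer_im γ τ, mul_sub, sub_mul, mul_assoc, moeb_mul_denom, ← conjTranspose_mul,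
      moeb_mul_denom]
  rw [h1, sub_conjTranspose (mat_transpose τ), mul_smul_comm, smul_mul_assoc] at h3
  have h4 := smul_right_injective _ h2 h3
  rw [star_eq_conjTranspose, h4, posDef_ofReal_iff]
  exact τ.2

/-- `γ` acts on the column `(X; Y)` by `(A X + B Y; C X + D Y)`, compatibly with products. -/
theorem blk_mul (γ δ : Sp n) :
    blkA (γ * δ) = blkA γ * blkA δ + blkB γ * blkC δ ∧
    blkB (γ * δ) = blkA γ * blkB δ + blkB γ * blkD δ ∧
    blkC (γ * δ) = blkC γ * blkA δ + blkD γ * blkC δ ∧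
    blkD (γ * δ) = blkC γ * blkB δ + blkD γ * blkD δ := by
  have h : (γ * δ).1.map (Int.cast : ℤ → ℂ) =
      γ.1.map (Int.cast : ℤ → ℂ) * δ.1.map (Int.cast : ℤ → ℂ) :=
    Matrix.map_mul (f := Int.castRingHom ℂ)
  rw [map_eq_blocks, map_eq_blocks, map_eq_blocks, fromBlocks_multiply, fromBlocks_inj] at h
  exact h

/-- The action `γ τ = (A τ + B) (C τ + D)⁻¹`. -/
instance : SMul (Sp n) (siegelSpace n) where
  smul γ τ := ⟨⟨moeb γ τ, moeb_transpose γ τ⟩, moeb_im_posDef γ τ⟩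

theorem mat_smul (γ : Sp n) (τ : siegelSpace n) :
    mat (γ • τ) = numer γ τ * (denom γ τ)⁻¹ := rfl

theorem mat_smul_mul_denom (γ : Sp n) (τ : siegelSpace n) :
    mat (γ • τ) * denom γ τ = numer γ τ := moeb_mul_denom γ τ

theorem denom_mul (γ δ : Sp n) (τ : siegelSpace n) :
    denom (γ * δ) τ = denom γ (δ • τ) * denom δ τ := by
  obtain ⟨-, -, hC, hD⟩ := blk_mul γ δ
  have : denom γ (δ • τ) * denom δ τ =
      blkC γ * (mat (δ • τ) * denom δ τ) + blkD γ * denom δ τ := by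
    simp only [denom]
    noncomm_ring
  rw [this, mat_smul_mul_denom, denom, hC, hD, numer, denom]
  noncomm_ring

theorem numer_mul (γ δ : Sp n) (τ : siegelSpace n) :
    numer (γ * δ) τ = numer γ (δ • τ) * denom δ τ := by
  obtain ⟨hA, hB, -, -⟩ := blk_mul γ δ
  have : numer γ (δ • τ) * denom δ τ =
      blkA γ * (mat (δ • τ) * denom δ τ) + blkB γ * denom δ τ := by
    simp only [numer]
    noncomm_ring
  rw [this, mat_smul_mul_denom, numer, hA, hB, numer, denom]
  noncomm_ring

theorem mat_injective : Function.Injective (mat : siegelSpace n → _) :=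
  fun _ _ h => Subtype.ext (Subtype.ext h)

/-- The symplectic group acts on the Siegel upper half-space. -/
instance : MulAction (Sp n) (siegelSpace n) where
  one_smul τ := by
    apply mat_injective
    have h : (1 : Sp n).1.map (Int.cast : ℤ → ℂ) = 1 := by
      ext i j
      simp [Matrix.one_apply]
    rw [map_eq_blocks, ← fromBlocks_one, fromBlocks_inj] at h
    obtain ⟨hA, hB, hC, hD⟩ := h
    rw [mat_smul, numer, denom, hA, hB, hC, hD]
    simp
  mul_smul γ δ τ := by
    apply mat_injective
    apply (isUnit_denom (γ * δ) τ).mul_right_cancel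
    rw [mat_smul_mul_denom, denom_mul, ← mul_assoc, mat_smul_mul_denom, numer_mul]

/-- The pairs `[γ, φ]` with `γ` in the symplectic group and `φ` a nowhere vanishing function on the
Siegel upper half-space. -/
@[ext]
structure AutPair (n : ℕ) where
  /-- the symplectic matrix `γ` -/
  elt : Sp n
  /-- the function `φ` -/
  fac : siegelSpace n → ℂˣ

/-- The product `[γ, φ] [γ', φ'] = [γ γ', φ(γ' τ) φ'(τ)]`, which makes the pairs a group. -/
instance : Group (AutPair n) where
  mul g h := ⟨g.elt * h.elt, fun τ => g.fac (h.elt • τ) * h.fac τ⟩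
  one := ⟨1, fun _ => 1⟩
  inv g := ⟨g.elt⁻¹, fun τ => (g.fac (g.elt⁻¹ • τ))⁻¹⟩
  mul_assoc a b c := by
    refine AutPair.ext (mul_assoc a.elt b.elt c.elt) (funext fun τ => ?_)
    change a.fac (b.elt • c.elt • τ) * b.fac (c.elt • τ) * c.fac τ =
      a.fac ((b.elt * c.elt) • τ) * (b.fac (c.elt • τ) * c.fac τ)
    rw [mul_smul, mul_assoc]
  one_mul a := by
    refine AutPair.ext (one_mul a.elt) (funext fun τ => ?_)
    exact one_mul (a.fac τ)
  mul_one a := by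
    refine AutPair.ext (mul_one a.elt) (funext fun τ => ?_)
    change a.fac ((1 : Sp n) • τ) * 1 = a.fac τ
    rw [one_smul, mul_one]
  inv_mul_cancel a := by
    refine AutPair.ext (inv_mul_cancel a.elt) (funext fun τ => ?_)
    change (a.fac (a.elt⁻¹ • a.elt • τ))⁻¹ * a.fac τ = 1
    rw [inv_smul_smul, inv_mul_cancel]

theorem AutPair.mul_elt (g h : AutPair n) : (g * h).elt = g.elt * h.elt := rfl

theorem AutPair.mul_fac (g h : AutPair n) (τ : siegelSpace n) :
    (g * h).fac τ = g.fac (h.elt • τ) * h.fac τ := rfl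

/-- `φ` is an automorphy factor for `γ = (A B; C D)`: it is analytic on the Siegel upper half-space
(an open subset of the space of symmetric matrices) and `|φ(τ)|² = |det (C τ + D)|`. The extension
of `φ` by `0` to all symmetric matrices does not matter. -/
def IsAutomorphyFactor (γ : Sp n) (φ : siegelSpace n → ℂˣ) : Prop :=
  AnalyticOnNhd ℂ
      (Function.extend (Subtype.val : siegelSpace n → symMat n) (fun τ => (φ τ : ℂ)) 0)
      (siegelSpace n) ∧
    ∀ τ : siegelSpace n, ‖(φ τ : ℂ)‖ ^ 2 = ‖(denom γ τ).det‖

/-- The Siegel theta series `θ(τ) = ∑_U exp(π i Tr(2 ᵗU U τ))`, the sum over all integral row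
vectors `U` of length `n`. -/
def theta (τ : siegelSpace n) : ℂ :=
  ∑' u : Fin n → ℤ, Complex.exp (Real.pi * Complex.I *
    ((2 : ℂ) • (vecMulVec (fun i => (u i : ℂ)) (fun i => (u i : ℂ)) * mat τ)).trace)

/-- `Γ₀(4)` in degree `n`: the symplectic matrices with `C ≡ 0` modulo `4`. -/
def gammaZeroFour (n : ℕ) : Set (Sp n) :=
  {γ | ∀ i j, (4 : ℤ) ∣ γ.1.toBlocks₂₁ i j}

/-- The theta cover of `Γ₀(4)`: the pairs `[γ, θ(γ τ) / θ(τ)]` with `γ` in `Γ₀(4)`.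
In degree at least `2` the series `θ` has zeros, and the quotient means the automorphy factor `φ`
with `θ(γ τ) = φ(τ) θ(τ)` for all `τ` (it is unique, `θ` not being identically zero). -/
def thetaCover (n : ℕ) : Set (AutPair n) :=
  {g | g.elt ∈ gammaZeroFour n ∧ IsAutomorphyFactor g.elt g.fac ∧
    ∀ τ : siegelSpace n, theta (g.elt • τ) = (g.fac τ : ℂ) * theta τ}

/-- `G` is a cover of `Γ`: a group of pairs `[γ, φ]` with `γ` in `Γ` and `φ` an automorphy factor
for `γ`. -/
def IsCover (Γ : Subgroup (Sp n)) (G : Subgroup (AutPair n)) : Prop :=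
  ∀ g ∈ G, g.elt ∈ Γ ∧ IsAutomorphyFactor g.elt g.fac

/-- `G` is a one-fold cover of `Γ`: a cover with exactly one element above each `γ` in `Γ`. -/
def IsOneFoldCover (Γ : Subgroup (Sp n)) (G : Subgroup (AutPair n)) : Prop :=
  IsCover Γ G ∧ ∀ γ ∈ Γ, ∃! g : AutPair n, g ∈ G ∧ g.elt = γ

/-- The matrix `I_d ⊥ 2 I_{d'} ⊥ ⟨0⟩^{n-d-d'}`. -/
def shapePlus (n d d' : ℕ) : Matrix (Fin n) (Fin n) ℤ :=
  diagonal fun i => if i.1 < d then 1 else if i.1 < d + d' then 2 else 0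

/-- The matrix `I_d ⊥ (0 2; 2 0)^{e} ⊥ ⟨0⟩^{n-d-2e}`, with `e` blocks `(0 2; 2 0)`: rows
`d + 2t` and `d + 2t + 1`, for `t < e`, form a block. -/
def shapeMinus (n d e : ℕ) : Matrix (Fin n) (Fin n) ℤ :=
  Matrix.of fun i j =>
    if i = j then (if i.1 < d then 1 else 0)
    else if ∃ t < e, (i.1 = d + 2 * t ∧ j.1 = d + 2 * t + 1) ∨
        (j.1 = d + 2 * t ∧ i.1 = d + 2 * t + 1) then 2
    else 0

/-- Entrywise congruence of integral matrices modulo `4`. -/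
def CongrFour (M N : Matrix (Fin n) (Fin n) ℤ) : Prop := ∀ i j, M i j ≡ N i j [ZMOD 4]

/-- The identification of `SL₂(ℤ)` with the symplectic group of degree `1`: the matrix
`(a b; c d)` is read in `1 × 1` blocks. -/
def slToSp : SL(2, ℤ) ≃* Sp 1 where
  toFun g := ⟨g.1.submatrix (finSumFinEquiv (m := 1) (n := 1)) (finSumFinEquiv (m := 1) (n := 1)), by
    have h := g.2
    rw [det_fin_two] at h
    have e : g.1.submatrix (finSumFinEquiv (m := 1) (n := 1)) (finSumFinEquiv (m := 1) (n := 1)) =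
        fromBlocks !![g.1 0 0] !![g.1 0 1] !![g.1 1 0] !![g.1 1 1] := by
      ext i j
      rcases i with i | i <;> rcases j with j | j <;> fin_cases i <;> fin_cases j <;> rfl
    rw [e, SymplecticGroup.fromBlocks_mem_iff]
    refine ⟨?_, ?_, ?_⟩ <;> ext i j <;> fin_cases i <;> fin_cases j <;>
      simp [Matrix.mul_apply] <;> linarith⟩
  invFun γ := ⟨γ.1.submatrix (finSumFinEquiv (m := 1) (n := 1)).symm
      (finSumFinEquiv (m := 1) (n := 1)).symm, by
    rw [det_submatrix_equiv_self]
    exact SymplecticGroup.det_eq_one γ.2⟩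
  left_inv g := by
    apply Subtype.ext
    simp [submatrix_submatrix]
  right_inv γ := by
    apply Subtype.ext
    simp [submatrix_submatrix]
  map_mul' g h := by
    apply Subtype.ext
    change (g.1 * h.1).submatrix _ _ = g.1.submatrix _ _ * h.1.submatrix _ _
    rw [submatrix_mul_equiv]

end SiegelTheta

end

/-!
The idea is to attach a constant to every element of a one-fold cover and to compute it in
two incompatible ways.

If `φ` is an automorphy factor for `γ = (A B; C D)`, then `φ² / det (C τ + D)` is analytic of constant
absolute value on a connected domain, hence a constant `c`, the multiplier of `[γ, φ]`
(`IsAutomorphyFactor.exists_sq_eq`). Multipliers are multiplicative. In a one-fold cover `G` they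
depend on `γ` alone; for `γ = (1 0; N 1)` this gives a partial function `N ↦ c(N)` on integral
symmetric matrices, a homomorphism on a group of matrices, invariant under `N ↦ W N ᵗW` for unimodular
`W` (`LowerMultiplier.sub`, `LowerMultiplier.conj`). Two facts restrict it.

* The theta cover forces `c(N) = 1` if the only nonzero entry of `N` is a `4` on the diagonal. This
  is the one place where a genuine theta transformation enters. It concerns the summation over a
  single variable, and follows from the functional equation of the Jacobi theta function
  (`theta_lowerSp_single_smul`, `exists_mem_thetaCover_lowerSp_single`).
* Let `D` be the diagonal matrix with entries `1` on a set `s` of indices and `0` elsewhere. The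
  element `(1 -D; 0 1) (1 0; 2D 1)` has a fixed point, and its square is `(1 - 2D 0; 0 1 - 2D)`, under
  which theta is invariant. At the fixed point the factor therefore has square `1`, and
  `det (2 D τ + 1) = i ^ |s|`; this yields `c(2D) i ^ |s| = 1` (`LowerMultiplier.mul_I_pow_card`).

The matrices `M` of both shapes lead to some `2D` with `s` nonempty: modulo `4`, either `M` or `2M` is
of this form. If `s` has one element, then `c(2D)² = c(4D) = 1` contradicts `c(2D) i = 1`. If `s` has
two distinct elements `a`, `b`, subtracting `2D` from its transform by a transvection gives a form
with `c = 1` which, after a change of variables and the addition of `4` at the entry `(b, b)`, is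
`2 D_{a,b}` (`lowerMultiplier_pair`). So `c(2 D_{a,b}) = 1`, against `c(2 D_{a,b}) i² = 1`.

In degree one, every subgroup strictly containing `Γ₀(4)` contains `(1 0; 1 1)` or `(1 0; 2 1)`
(`exists_lowerSL_mem`), so the general result applies.
-/

noncomputable section

namespace SiegelTheta

-- The same choice of norm as in the definition of automorphy factors.
attribute [local instance] Matrix.normedAddCommGroup Matrix.normedSpace

variable {n : ℕ}

/-! ### Geometry of the Siegel upper half-space -/

theorem dotProduct_mulVec_smul (Y : Matrix (Fin n) (Fin n) ℝ) (a : ℝ) (x : Fin n → ℝ) :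
    (a • x) ⬝ᵥ (Y *ᵥ (a • x)) = a ^ 2 * (x ⬝ᵥ (Y *ᵥ x)) := by
  rw [mulVec_smul, dotProduct_smul, smul_dotProduct, smul_eq_mul, smul_eq_mul]
  ring

/-- Positive definiteness has to be tested on the unit sphere only. -/
theorem posDef_iff_sphere {Y : Matrix (Fin n) (Fin n) ℝ} (hY : Y.IsHermitian) :
    Y.PosDef ↔ ∀ x ∈ Metric.sphere (0 : Fin n → ℝ) 1, 0 < x ⬝ᵥ (Y *ᵥ x) := by
  rw [posDef_iff_dotProduct_mulVec]
  constructor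
  · rintro ⟨-, h⟩ x hx
    exact h (ne_zero_of_mem_unit_sphere ⟨x, hx⟩)
  · refine fun h => ⟨hY, fun x hx => ?_⟩
    have hn : 0 < ‖x‖ := norm_pos_iff.mpr hx
    have h1 := h (‖x‖⁻¹ • x) (by simp [norm_smul, hn.ne'])
    rw [dotProduct_mulVec_smul] at h1
    exact pos_of_mul_pos_right h1 (by positivity)

/-- A positive definite form is bounded below by a positive multiple of the sum of squares. -/
theorem _root_.Matrix.PosDef.exists_lower_bound {Y : Matrix (Fin n) (Fin n) ℝ} (hY : Y.PosDef) :
    ∃ ε > 0, ∀ x : Fin n → ℝ, ε * (x ⬝ᵥ x) ≤ x ⬝ᵥ (Y *ᵥ x) := by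
  have hpos : ∀ x ∈ Metric.sphere (0 : Fin n → ℝ) 1, 0 < x ⬝ᵥ x := fun x hx => by
    have := (posDef_iff_sphere (isHermitian_one (n := Fin n) (α := ℝ))).mp PosDef.one x hx
    rwa [one_mulVec] at this
  have hcont : ContinuousOn (fun x : Fin n → ℝ => (x ⬝ᵥ (Y *ᵥ x)) / (x ⬝ᵥ x))
      (Metric.sphere (0 : Fin n → ℝ) 1) := by
    refine ContinuousOn.div ?_ ?_ fun x hx => (hpos x hx).ne'
    · fun_prop
    · fun_prop
  obtain ⟨ε, hε, h⟩ := (isCompact_sphere (0 : Fin n → ℝ) 1).exists_forall_le' hcont (a := 0)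
    fun x hx => div_pos ((posDef_iff_sphere hY.1).mp hY x hx) (hpos x hx)
  refine ⟨ε, hε, fun x => ?_⟩
  rcases eq_or_ne x 0 with rfl | hx
  · simp
  have hn : 0 < ‖x‖ := norm_pos_iff.mpr hx
  have hs : ‖x‖⁻¹ • x ∈ Metric.sphere (0 : Fin n → ℝ) 1 := by simp [norm_smul, hn.ne']
  have h1 := h _ hs
  rw [le_div_iff₀ (hpos _ hs), dotProduct_mulVec_smul, smul_dotProduct, dotProduct_smul,
    smul_eq_mul, smul_eq_mul] at h1
  have h2 : ‖x‖⁻¹ ^ 2 * (ε * (x ⬝ᵥ x)) ≤ ‖x‖⁻¹ ^ 2 * (x ⬝ᵥ (Y *ᵥ x)) := by linarith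
  exact le_of_mul_le_mul_left h2 (by positivity)

theorem isHermitian_im (Z : symMat n) :
    ((Z : Matrix (Fin n) (Fin n) ℂ).map Complex.im).IsHermitian := by
  ext i j
  have : Z.1 j i = Z.1 i j := congrFun (congrFun Z.2 i) j
  simp [this]

theorem isOpen_siegelSpace : IsOpen (siegelSpace n) := by
  rw [isOpen_iff_eventually]
  intro Z hZ
  have hcont : Continuous fun p : symMat n × (Fin n → ℝ) =>
      p.2 ⬝ᵥ ((p.1 : Matrix (Fin n) (Fin n) ℂ).map Complex.im *ᵥ p.2) := by
    have h : Continuous fun p : symMat n × (Fin n → ℝ) =>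
        (p.1 : Matrix (Fin n) (Fin n) ℂ).map Complex.im :=
      (continuous_subtype_val.comp continuous_fst).matrix_map Complex.continuous_im
    exact continuous_snd.dotProduct (h.matrix_mulVec continuous_snd)
  have := (isCompact_sphere (0 : Fin n → ℝ) 1).eventually_forall_of_forall_eventually (x₀ := Z)
    (P := fun Z x => 0 < x ⬝ᵥ ((Z : Matrix (Fin n) (Fin n) ℂ).map Complex.im *ᵥ x))
    fun x hx => hcont.continuousAt.eventually
      (lt_mem_nhds ((posDef_iff_sphere (isHermitian_im Z)).mp hZ x hx))
  filter_upwards [this] with W hW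
  exact (posDef_iff_sphere (isHermitian_im W)).mpr hW

theorem isPreconnected_siegelSpace : IsPreconnected (siegelSpace n) := by
  have : ContinuousSMul ℝ (symMat n) := IsScalarTower.continuousSMul ℂ
  refine Convex.isPreconnected ?_
  rw [convex_iff_forall_pos]
  intro Z hZ W hW a b ha hb _
  have h1 : ((Z : Matrix (Fin n) (Fin n) ℂ).map Complex.im).PosDef := hZ
  have h2 : ((W : Matrix (Fin n) (Fin n) ℂ).map Complex.im).PosDef := hW
  have h3 := (h1.smul ha).add (h2.smul hb)
  have e : ((a • Z + b • W : symMat n) : Matrix (Fin n) (Fin n) ℂ).map Complex.im =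
      a • (Z : Matrix (Fin n) (Fin n) ℂ).map Complex.im +
      b • (W : Matrix (Fin n) (Fin n) ℂ).map Complex.im := by
    ext i j
    simp
  rw [← e] at h3
  exact h3

/-- A diagonal point of the Siegel upper half-space. -/
def diagPoint (z : Fin n → ℂ) (hz : ∀ i, 0 < (z i).im) : siegelSpace n :=
  ⟨⟨diagonal z, diagonal_transpose z⟩, by
    have : (diagonal z).map Complex.im = diagonal fun i => (z i).im := by
      rw [diagonal_map Complex.zero_im]
    change ((diagonal z).map Complex.im).PosDef
    rw [this]
    exact PosDef.diagonal hz⟩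

theorem mat_diagPoint (z : Fin n → ℂ) (hz : ∀ i, 0 < (z i).im) :
    mat (diagPoint z hz) = diagonal z := rfl

instance : Nonempty (siegelSpace n) := ⟨diagPoint (fun _ => Complex.I) (by simp)⟩

/-! ### Automorphy factors -/

theorem extend_val (φ : siegelSpace n → ℂˣ) (τ : siegelSpace n) :
    Function.extend (Subtype.val : siegelSpace n → symMat n) (fun τ => (φ τ : ℂ)) 0 τ.1 = φ τ :=
  Subtype.val_injective.extend_apply _ _ τ

theorem analyticOnNhd_apply (i j : Fin n) (U : Set (symMat n)) :
    AnalyticOnNhd ℂ (fun Z : symMat n => (Z : Matrix (Fin n) (Fin n) ℂ) i j) U :=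
  (LinearMap.toContinuousLinearMap
    ((Matrix.entryLinearMap ℂ ℂ i j).comp (symMat n).subtype)).analyticOnNhd U

theorem analyticOnNhd_det_denom (γ : Sp n) (U : Set (symMat n)) :
    AnalyticOnNhd ℂ
      (fun Z : symMat n => (blkC γ * (Z : Matrix (Fin n) (Fin n) ℂ) + blkD γ).det) U := by
  simp only [det_apply', Matrix.add_apply, Matrix.mul_apply]
  refine Finset.analyticOnNhd_fun_sum _ fun σ _ => analyticOnNhd_const.mul ?_
  refine Finset.analyticOnNhd_fun_prod _ fun i _ => AnalyticOnNhd.add ?_ analyticOnNhd_const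
  exact Finset.analyticOnNhd_fun_sum _ fun k _ =>
    analyticOnNhd_const.mul (analyticOnNhd_apply _ _ U)

/-- The square of an automorphy factor is a constant multiple of `det (C τ + D)`: the quotient is
analytic of constant absolute value on a connected domain. -/
theorem IsAutomorphyFactor.exists_sq_eq {γ : Sp n} {φ : siegelSpace n → ℂˣ}
    (h : IsAutomorphyFactor γ φ) : ∃ c : ℂ, ∀ τ, (φ τ : ℂ) ^ 2 = c * (denom γ τ).det := by
  set f := Function.extend (Subtype.val : siegelSpace n → symMat n) (fun τ => (φ τ : ℂ)) 0
  set q : symMat n → ℂ := fun Z => f Z ^ 2 / (blkC γ * (Z : Matrix (Fin n) (Fin n) ℂ) + blkD γ).det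
  have hq : ∀ τ : siegelSpace n, q τ.1 = (φ τ : ℂ) ^ 2 / (denom γ τ).det := fun τ => by
    simp only [q, f, extend_val]
    rfl
  have hd : AnalyticOnNhd ℂ q (siegelSpace n) :=
    (h.1.pow 2).div (analyticOnNhd_det_denom γ _) fun Z hZ =>
      (isUnit_det_denom γ ⟨Z, hZ⟩).ne_zero
  have hnorm : ∀ τ : siegelSpace n, ‖q τ.1‖ = 1 := fun τ => by
    rw [hq, norm_div, norm_pow, h.2, div_self]
    exact norm_ne_zero_iff.mpr (isUnit_det_denom γ τ).ne_zero
  let τ₀ : siegelSpace n := Classical.arbitrary _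
  have hmax : IsMaxOn (norm ∘ q) (siegelSpace n) τ₀.1 := fun Z hZ => by
    have h1 := hnorm ⟨Z, hZ⟩
    have h2 := hnorm τ₀
    simp only [Set.mem_ofPred_eq, Function.comp_apply]
    rw [h1, h2]
  refine ⟨q τ₀.1, fun τ => ?_⟩
  have := Complex.eqOn_of_isPreconnected_of_isMaxOn_norm isPreconnected_siegelSpace
    isOpen_siegelSpace hd.differentiableOn τ₀.2 hmax τ.2
  rw [hq, Function.const_apply, div_eq_iff (isUnit_det_denom γ τ).ne_zero] at this
  exact this

/-- An analytic function on the space of symmetric matrices restricts to an automorphy factor if its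
absolute values on the Siegel upper half-space are the right ones. -/
theorem isAutomorphyFactor_of_analyticOnNhd {γ : Sp n} {φ : siegelSpace n → ℂˣ} (f : symMat n → ℂ)
    (hf : AnalyticOnNhd ℂ f (siegelSpace n)) (hφ : ∀ τ : siegelSpace n, (φ τ : ℂ) = f τ.1)
    (hn : ∀ τ : siegelSpace n, ‖(φ τ : ℂ)‖ ^ 2 = ‖(denom γ τ).det‖) : IsAutomorphyFactor γ φ := by
  refine ⟨hf.congr isOpen_siegelSpace fun Z hZ => ?_, hn⟩
  rw [← hφ ⟨Z, hZ⟩]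
  exact (extend_val φ ⟨Z, hZ⟩).symm

/-! ### Unipotent and block diagonal elements -/

/-- The lower unipotent element `(1 0; N 1)`. -/
def lowerSp (N : Matrix (Fin n) (Fin n) ℤ) (hN : Nᵀ = N) : Sp n :=
  ⟨fromBlocks 1 0 N 1, by rw [SymplecticGroup.fromBlocks_mem_iff]; simp [hN]⟩

/-- The upper unipotent element `(1 B; 0 1)`. -/
def upperSp (B : Matrix (Fin n) (Fin n) ℤ) (hB : Bᵀ = B) : Sp n :=
  ⟨fromBlocks 1 B 0 1, by rw [SymplecticGroup.fromBlocks_mem_iff]; simp [hB]⟩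

/-- The block diagonal element `(V 0; 0 W)`, where `W` is the inverse transpose of `V`. -/
def leviSp (V W : Matrix (Fin n) (Fin n) ℤ) (h : Vᵀ * W = 1) : Sp n :=
  ⟨fromBlocks V 0 0 W, by rw [SymplecticGroup.fromBlocks_mem_iff]; simp [h]⟩

theorem map_one_cast : (1 : Matrix (Fin n) (Fin n) ℤ).map (Int.cast : ℤ → ℂ) = 1 :=
  Matrix.map_one _ Int.cast_zero Int.cast_one

theorem numer_lowerSp (N : Matrix (Fin n) (Fin n) ℤ) (hN : Nᵀ = N) (τ : siegelSpace n) :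
    numer (lowerSp N hN) τ = mat τ := by
  simp [numer, blkA, blkB, lowerSp]

theorem denom_lowerSp (N : Matrix (Fin n) (Fin n) ℤ) (hN : Nᵀ = N) (τ : siegelSpace n) :
    denom (lowerSp N hN) τ = N.map (Int.cast : ℤ → ℂ) * mat τ + 1 := by
  simp [denom, blkC, blkD, lowerSp]

theorem denom_upperSp (B : Matrix (Fin n) (Fin n) ℤ) (hB : Bᵀ = B) (τ : siegelSpace n) :
    denom (upperSp B hB) τ = 1 := by
  simp [denom, blkC, blkD, upperSp]

theorem mat_upperSp_smul (B : Matrix (Fin n) (Fin n) ℤ) (hB : Bᵀ = B) (τ : siegelSpace n) :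
    mat (upperSp B hB • τ) = mat τ + B.map (Int.cast : ℤ → ℂ) := by
  rw [mat_smul, denom_upperSp]
  simp [numer, blkA, blkB, upperSp]

theorem denom_leviSp (V W : Matrix (Fin n) (Fin n) ℤ) (h : Vᵀ * W = 1) (τ : siegelSpace n) :
    denom (leviSp V W h) τ = W.map (Int.cast : ℤ → ℂ) := by
  simp [denom, blkC, blkD, leviSp]

theorem mat_leviSp_smul (V W : Matrix (Fin n) (Fin n) ℤ) (h : Vᵀ * W = 1) (τ : siegelSpace n) :
    mat (leviSp V W h • τ) =
      V.map (Int.cast : ℤ → ℂ) * mat τ * (V.map (Int.cast : ℤ → ℂ))ᵀ := by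
  apply (isUnit_denom (leviSp V W h) τ).mul_right_cancel
  have hc : (V.map (Int.cast : ℤ → ℂ))ᵀ * W.map (Int.cast : ℤ → ℂ) = 1 := by
    rw [← map_one_cast, ← h, ← transpose_map]
    exact (Matrix.map_mul (f := Int.castRingHom ℂ)).symm
  rw [mat_smul_mul_denom, denom_leviSp, mul_assoc, hc]
  simp [numer, blkA, blkB, leviSp]

/-! ### Elementary invariances of the theta series -/

/-- The integral quadratic form `u ↦ u Z ᵗu`. -/
def quad (Z : Matrix (Fin n) (Fin n) ℂ) (u : Fin n → ℤ) : ℂ :=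
  (fun i => (u i : ℂ)) ⬝ᵥ (Z *ᵥ fun i => (u i : ℂ))

theorem theta_eq (τ : siegelSpace n) :
    theta τ = ∑' u : Fin n → ℤ, Complex.exp (2 * Real.pi * Complex.I * quad (mat τ) u) := by
  refine tsum_congr fun u => ?_
  rw [vecMulVec_mul, trace_smul, trace_vecMulVec, quad, dotProduct_mulVec, dotProduct_comm,
    smul_eq_mul]
  ring_nf

theorem theta_upperSp_smul (B : Matrix (Fin n) (Fin n) ℤ) (hB : Bᵀ = B) (τ : siegelSpace n) :
    theta (upperSp B hB • τ) = theta τ := by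
  rw [theta_eq, theta_eq]
  refine tsum_congr fun u => ?_
  have : quad (B.map (Int.cast : ℤ → ℂ)) u = ((u ⬝ᵥ (B *ᵥ u) : ℤ) : ℂ) := by
    simp [quad, dotProduct, mulVec]
  have h : quad (mat τ + B.map (Int.cast : ℤ → ℂ)) u = quad (mat τ) u +
      quad (B.map (Int.cast : ℤ → ℂ)) u := by
    simp only [quad, add_mulVec, dotProduct_add]
  rw [mat_upperSp_smul, h, this, mul_add, Complex.exp_add, mul_comm (2 * _ * _) ((_ : ℤ) : ℂ),
    Complex.exp_int_mul_two_pi_mul_I, mul_one]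

theorem theta_leviSp_smul (V W : Matrix (Fin n) (Fin n) ℤ) (h : Vᵀ * W = 1) (τ : siegelSpace n) :
    theta (leviSp V W h • τ) = theta τ := by
  rw [theta_eq, theta_eq]
  let e : (Fin n → ℤ) ≃ (Fin n → ℤ) :=
    { toFun := fun u => Vᵀ *ᵥ u
      invFun := fun u => W *ᵥ u
      left_inv := fun u => by simp [mul_eq_one_comm.mp h]
      right_inv := fun u => by simp [h] }
  rw [← e.tsum_eq fun u => Complex.exp (2 * Real.pi * Complex.I * quad (mat τ) u)]
  refine tsum_congr fun u => ?_
  have : (fun i => (e u i : ℂ)) = (V.map (Int.cast : ℤ → ℂ))ᵀ *ᵥ fun i => (u i : ℂ) := by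
    ext i
    simp [e, mulVec, dotProduct]
  rw [mat_leviSp_smul, quad, quad, this, ← mulVec_mulVec, ← mulVec_mulVec, dotProduct_mulVec,
    ← mulVec_transpose]

theorem mem_thetaCover_of_invariant {γ : Sp n} (hγ : γ ∈ gammaZeroFour n)
    (hdet : ∀ τ, ‖(denom γ τ).det‖ = 1) (hθ : ∀ τ : siegelSpace n, theta (γ • τ) = theta τ) :
    (⟨γ, fun _ => 1⟩ : AutPair n) ∈ thetaCover n := by
  refine ⟨hγ, ?_, fun τ => by simp [hθ]⟩
  exact isAutomorphyFactor_of_analyticOnNhd (fun _ => 1) analyticOnNhd_const (by simp)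
    (by simp [hdet])

theorem upperSp_mem_thetaCover (B : Matrix (Fin n) (Fin n) ℤ) (hB : Bᵀ = B) :
    (⟨upperSp B hB, fun _ => 1⟩ : AutPair n) ∈ thetaCover n :=
  mem_thetaCover_of_invariant (fun i j => by simp [upperSp]) (by simp [denom_upperSp])
    (theta_upperSp_smul B hB)

theorem leviSp_mem_thetaCover (V W : Matrix (Fin n) (Fin n) ℤ) (h : Vᵀ * W = 1) :
    (⟨leviSp V W h, fun _ => 1⟩ : AutPair n) ∈ thetaCover n := by
  refine mem_thetaCover_of_invariant (fun i j => by simp [leviSp]) (fun τ => ?_)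
    (theta_leviSp_smul V W h)
  have hu : IsUnit W.det := isUnit_det_of_left_inverse h
  have hd : (W.map (Int.cast : ℤ → ℂ)).det = (W.det : ℂ) :=
    (RingHom.map_det (Int.castRingHom ℂ) W).symm
  rw [denom_leviSp, hd]
  rcases Int.isUnit_iff.mp hu with h1 | h1 <;> simp [h1]

/-! ### Convergence of the theta series -/

theorem summable_pi_prod {f : ℤ → ℝ} (hf : Summable f) (h0 : 0 ≤ f) :
    ∀ n : ℕ, Summable fun u : Fin n → ℤ => ∏ i, f (u i)
  | 0 => Summable.of_finite
  | n + 1 => by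
    have h := hf.mul_of_nonneg (summable_pi_prod hf h0 n) h0
      fun u => Finset.prod_nonneg fun i _ => h0 (u i)
    rw [← (Fin.consEquiv fun _ : Fin (n + 1) => ℤ).summable_iff]
    refine h.congr fun p => ?_
    simp [Fin.prod_univ_succ, Fin.consEquiv]

theorem im_quad (Z : Matrix (Fin n) (Fin n) ℂ) (u : Fin n → ℤ) :
    (quad Z u).im = (fun i => (u i : ℝ)) ⬝ᵥ (Z.map Complex.im *ᵥ fun i => (u i : ℝ)) := by
  simp [quad, dotProduct, mulVec]

theorem summable_theta (τ : siegelSpace n) : Summable fun u : Fin n → ℤ =>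
    Complex.exp (2 * Real.pi * Complex.I * quad (mat τ) u) := by
  have hτ : ((mat τ).map Complex.im).PosDef := τ.2
  obtain ⟨ε, hε, h⟩ := hτ.exists_lower_bound
  have h1 : Summable fun m : ℤ => Real.exp (-(2 * Real.pi * ε) * (m : ℝ) ^ 2) := by
    refine (summable_pow_mul_jacobiTheta₂_term_bound 0 (T := 2 * ε) (by positivity) 0).congr
      fun m => ?_
    simp only [pow_zero, one_mul, mul_zero, zero_mul, sub_zero]
    congr 1
    ring
  refine (summable_pi_prod h1 (fun m => (Real.exp_pos _).le) n).of_norm_bounded fun u => ?_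
  rw [Complex.norm_exp, ← Real.exp_sum, Real.exp_le_exp, ← Finset.mul_sum]
  have h2 : (2 * Real.pi * Complex.I * quad (mat τ) u).re =
      -(2 * Real.pi) * (quad (mat τ) u).im := by
    simp
  have h3 := h fun i => (u i : ℝ)
  have h4 : (fun i => (u i : ℝ)) ⬝ᵥ (fun i => (u i : ℝ)) = ∑ i, (u i : ℝ) ^ 2 := by
    simp [dotProduct, sq]
  rw [h4] at h3
  rw [h2, im_quad]
  nlinarith [Real.pi_pos]

/-! ### The theta transformation in one variable -/

/-- The transformation of the Jacobi theta function under `σ ↦ σ / (1 + 2 σ)`, obtained by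
conjugating the translation `σ ↦ σ - 2` with the inversion. -/
theorem jacobiTheta₂_div_one_add (z : ℂ) {σ : ℂ} (hσ : 0 < σ.im) :
    jacobiTheta₂ (z / (1 + 2 * σ)) (σ / (1 + 2 * σ)) =
      (-Complex.I * σ) ^ (1 / 2 : ℂ) / (-Complex.I * (σ / (1 + 2 * σ))) ^ (1 / 2 : ℂ) *
        Complex.exp (2 * Real.pi * Complex.I * z ^ 2 / (1 + 2 * σ)) * jacobiTheta₂ z σ := by
  have h0 : σ ≠ 0 := fun h => by simp [h] at hσ
  have h1 : 1 + 2 * σ ≠ 0 := fun h => by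
    have := congrArg Complex.im h
    simp at this
    exact hσ.ne' this
  have hcp : (-Complex.I * σ) ^ (1 / 2 : ℂ) ≠ 0 := by
    rw [Complex.cpow_ne_zero_iff]
    left
    simp [h0]
  rw [jacobiTheta₂_functional_equation z σ,
    jacobiTheta₂_functional_equation (z / (1 + 2 * σ)) (σ / (1 + 2 * σ))]
  have e1 : z / (1 + 2 * σ) / (σ / (1 + 2 * σ)) = z / σ := by field_simp
  have e2 : -1 / (σ / (1 + 2 * σ)) + 2 = -1 / σ := by field_simp; ring
  rw [e1, ← jacobiTheta₂_add_right _ (-1 / (σ / (1 + 2 * σ))), e2]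
  have e3 : Complex.exp (-Real.pi * Complex.I * (z / (1 + 2 * σ)) ^ 2 / (σ / (1 + 2 * σ))) =
      Complex.exp (2 * Real.pi * Complex.I * z ^ 2 / (1 + 2 * σ)) *
        Complex.exp (-Real.pi * Complex.I * z ^ 2 / σ) := by
    rw [← Complex.exp_add]
    congr 1
    field_simp
    ring
  rw [e3]
  field_simp

/-- The integral vector with coordinate `a` at `k` and the other coordinates `w`. -/
def splitAt (k : Fin n) : ({j // j ≠ k} → ℤ) × ℤ ≃ (Fin n → ℤ) :=
  (Equiv.prodComm _ _).trans (Equiv.funSplitAt k ℤ).symm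

theorem splitAt_apply (k : Fin n) (w : {j // j ≠ k} → ℤ) (a : ℤ) :
    splitAt k (w, a) = splitAt k (w, 0) + Pi.single k a := by
  ext i
  by_cases h : i = k
  · subst h
    simp [splitAt]
  · simp [splitAt, h]

theorem quad_add_single {Z : Matrix (Fin n) (Fin n) ℂ} (hZ : Zᵀ = Z) (u : Fin n → ℤ) (k : Fin n)
    (a : ℤ) : quad Z (u + Pi.single k a) =
      quad Z u + 2 * a * (Z *ᵥ fun i => (u i : ℂ)) k + a ^ 2 * Z k k := by
  have e : (fun i => ((u + Pi.single k a : Fin n → ℤ) i : ℂ)) =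
      (fun i => (u i : ℂ)) + Pi.single k (a : ℂ) := by
    ext i
    by_cases h : i = k
    · subst h
      simp
    · simp [h]
  have h1 : (fun i => (u i : ℂ)) ⬝ᵥ (Z *ᵥ Pi.single k (a : ℂ)) =
      a * (Z *ᵥ fun i => (u i : ℂ)) k := by
    rw [dotProduct_mulVec, ← mulVec_transpose, hZ, dotProduct_single, mul_comm]
  rw [quad, e, mulVec_add, dotProduct_add, add_dotProduct, add_dotProduct, h1,
    single_dotProduct, single_dotProduct, mulVec_single, quad]
  simp
  ring

/-- The partial summation of the theta series over one variable gives Jacobi theta functions. -/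
theorem theta_eq_tsum_jacobiTheta₂ (τ : siegelSpace n) (k : Fin n) :
    theta τ = ∑' w : {j // j ≠ k} → ℤ,
      Complex.exp (2 * Real.pi * Complex.I * quad (mat τ) (splitAt k (w, 0))) *
        jacobiTheta₂ (2 * (mat τ *ᵥ fun i => (splitAt k (w, 0) i : ℂ)) k) (2 * mat τ k k) := by
  have hs := summable_theta τ
  rw [theta_eq, ← (splitAt k).tsum_eq]
  rw [← (splitAt k).summable_iff] at hs
  refine hs.tsum_prod.trans ?_
  simp only [Function.comp_apply]
  refine tsum_congr fun w => ?_
  rw [jacobiTheta₂, ← tsum_mul_left]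
  refine tsum_congr fun a => ?_
  rw [splitAt_apply, quad_add_single (mat_transpose τ), jacobiTheta₂_term, ← Complex.exp_add]
  congr 1
  ring

theorem im_mat_apply_pos (τ : siegelSpace n) (k : Fin n) : 0 < (mat τ k k).im := by
  have hτ : ((mat τ).map Complex.im).PosDef := τ.2
  simpa using hτ.diag_pos (i := k)

theorem single_transpose (k : Fin n) (a : ℤ) :
    (Matrix.single k k a : Matrix (Fin n) (Fin n) ℤ)ᵀ = Matrix.single k k a :=
  Matrix.transpose_single _ _ _

theorem one_add_four_mul_ne_zero (τ : siegelSpace n) (k : Fin n) : 1 + 4 * mat τ k k ≠ 0 :=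
  fun h => by
    have := congrArg Complex.im h
    simp at this
    exact (im_mat_apply_pos τ k).ne' this

theorem denom_lowerSp_single (τ : siegelSpace n) (k : Fin n) (a : ℤ) :
    denom (lowerSp (Matrix.single k k a) (single_transpose k a)) τ =
      1 + vecMulVec (Pi.single k (a : ℂ)) (mat τ k) := by
  rw [denom_lowerSp, add_comm]
  congr 1
  ext i j
  simp only [Matrix.mul_apply, Matrix.map_apply, vecMulVec_apply]
  by_cases h : i = k
  · subst h
    rw [Finset.sum_eq_single i] <;> simp +contextual [eq_comm]
  · simp [h, Ne.symm h]

theorem det_denom_lowerSp_single (τ : siegelSpace n) (k : Fin n) (a : ℤ) :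
    (denom (lowerSp (Matrix.single k k a) (single_transpose k a)) τ).det =
      1 + a * mat τ k k := by
  rw [denom_lowerSp_single, vecMulVec_eq Unit, det_one_add_replicateCol_mul_replicateRow,
    dotProduct_single, mul_comm]

theorem mat_lowerSp_single_smul (τ : siegelSpace n) (k : Fin n) :
    mat (lowerSp (Matrix.single k k 4) (single_transpose k 4) • τ) =
      mat τ - (4 / (1 + 4 * mat τ k k)) • vecMulVec (mat τ k) (mat τ k) := by
  apply (isUnit_denom (lowerSp (Matrix.single k k 4) (single_transpose k 4)) τ).mul_right_cancel
  rw [mat_smul_mul_denom, denom_lowerSp_single, numer_lowerSp]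
  have h := one_add_four_mul_ne_zero τ k
  have h1 : mat τ *ᵥ Pi.single k ((4 : ℤ) : ℂ) = (4 : ℂ) • mat τ k := by
    ext i
    have : mat τ i k = mat τ k i := congrFun (congrFun (mat_transpose τ) k) i
    simp [this, mul_comm]
  have h2 : vecMulVec (mat τ k) (mat τ k) * vecMulVec (Pi.single k ((4 : ℤ) : ℂ)) (mat τ k) =
      (4 * mat τ k k) • vecMulVec (mat τ k) (mat τ k) := by
    rw [vecMulVec_mul_vecMulVec]
    ext i j
    simp [vecMulVec_apply]
    ring
  rw [mul_add, mul_one, sub_mul, mul_vecMulVec, h1, smul_mul_assoc, h2]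
  ext i j
  simp only [Matrix.add_apply, Matrix.sub_apply, Matrix.smul_apply, vecMulVec_apply,
    Pi.smul_apply, smul_eq_mul]
  field_simp
  ring

/-- The transformation of the theta series under `(1 0; N 1)`, where `N` has a single entry `4` on
the diagonal. Only the summation over one variable is affected, so the functional equation of the
Jacobi theta function is enough. -/
theorem theta_lowerSp_single_smul (τ : siegelSpace n) (k : Fin n) :
    theta (lowerSp (Matrix.single k k 4) (single_transpose k 4) • τ) =
      (-Complex.I * (2 * mat τ k k)) ^ (1 / 2 : ℂ) /
        (-Complex.I * (2 * mat τ k k / (1 + 2 * (2 * mat τ k k)))) ^ (1 / 2 : ℂ) * theta τ := by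
  rw [theta_eq_tsum_jacobiTheta₂ _ k, theta_eq_tsum_jacobiTheta₂ τ k, ← tsum_mul_left]
  refine tsum_congr fun w => ?_
  rw [mat_lowerSp_single_smul]
  have h := one_add_four_mul_ne_zero τ k
  have h' : 1 + 2 * (2 * mat τ k k) = 1 + 4 * mat τ k k := by ring
  set x : Fin n → ℂ := fun i => (splitAt k (w, 0) i : ℂ)
  have hs : mat τ k ⬝ᵥ x = (mat τ *ᵥ x) k := rfl
  have hq : quad (mat τ - (4 / (1 + 4 * mat τ k k)) • vecMulVec (mat τ k) (mat τ k))
      (splitAt k (w, 0)) =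
      quad (mat τ) (splitAt k (w, 0)) - 4 / (1 + 4 * mat τ k k) * (mat τ *ᵥ x) k ^ 2 := by
    simp only [quad]
    rw [sub_mulVec, dotProduct_sub, smul_mulVec, vecMulVec_mulVec, dotProduct_smul, hs,
      op_smul_eq_smul, dotProduct_smul, dotProduct_comm _ (mat τ k), hs, smul_eq_mul, smul_eq_mul]
    ring
  have hz : 2 * ((mat τ - (4 / (1 + 4 * mat τ k k)) • vecMulVec (mat τ k) (mat τ k)) *ᵥ x) k =
      2 * (mat τ *ᵥ x) k / (1 + 2 * (2 * mat τ k k)) := by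
    rw [sub_mulVec, smul_mulVec, vecMulVec_mulVec, hs]
    simp only [Pi.sub_apply, Pi.smul_apply, op_smul_eq_smul, smul_eq_mul, h']
    field_simp
    ring
  have hσ : 2 * (mat τ - (4 / (1 + 4 * mat τ k k)) • vecMulVec (mat τ k) (mat τ k)) k k =
      2 * mat τ k k / (1 + 2 * (2 * mat τ k k)) := by
    rw [Matrix.sub_apply, Matrix.smul_apply, vecMulVec_apply, smul_eq_mul, h',
      eq_div_iff h]
    linear_combination (-2 * mat τ k k ^ 2) * div_mul_cancel₀ (4 : ℂ) h
  have him : 0 < (2 * mat τ k k).im := by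
    simpa using im_mat_apply_pos τ k
  rw [hq, hz, hσ, jacobiTheta₂_div_one_add _ him]
  have he : Complex.exp (2 * Real.pi * Complex.I * (quad (mat τ) (splitAt k (w, 0)) -
      4 / (1 + 4 * mat τ k k) * (mat τ *ᵥ x) k ^ 2)) *
      Complex.exp (2 * Real.pi * Complex.I * (2 * (mat τ *ᵥ x) k) ^ 2 /
        (1 + 2 * (2 * mat τ k k))) =
      Complex.exp (2 * Real.pi * Complex.I * quad (mat τ) (splitAt k (w, 0))) := by
    rw [← Complex.exp_add, h']
    congr 1
    field_simp
    ring
  rw [← he]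
  ring

/-! ### Multipliers of automorphy factors -/

/-- The pair `[γ, φ]` has multiplier `c` if `φ(τ)² = c det (C τ + D)`. -/
def HasMultiplier (g : AutPair n) (c : ℂ) : Prop :=
  ∀ τ, (g.fac τ : ℂ) ^ 2 = c * (denom g.elt τ).det

theorem HasMultiplier.mul {g h : AutPair n} {c d : ℂ} (hg : HasMultiplier g c)
    (hh : HasMultiplier h d) : HasMultiplier (g * h) (c * d) := fun τ => by
  rw [AutPair.mul_fac, AutPair.mul_elt, denom_mul, det_mul, Units.val_mul, mul_pow, hg, hh]
  ring

theorem HasMultiplier.unique {g : AutPair n} {c d : ℂ} (hc : HasMultiplier g c)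
    (hd : HasMultiplier g d) : c = d := by
  let τ : siegelSpace n := Classical.arbitrary _
  exact mul_right_cancel₀ (isUnit_det_denom g.elt τ).ne_zero ((hc τ).symm.trans (hd τ))

theorem HasMultiplier.ne_zero {g : AutPair n} {c : ℂ} (hc : HasMultiplier g c) : c ≠ 0 := by
  rintro rfl
  let τ : siegelSpace n := Classical.arbitrary _
  have := hc τ
  simp at this

theorem sq_cpow_half (z : ℂ) : (z ^ (1 / 2 : ℂ)) ^ 2 = z := by
  have := Complex.cpow_nat_inv_pow z two_ne_zero
  rwa [Nat.cast_ofNat, ← one_div] at this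

/-- The transformation of the theta series under `(1 0; N 1)`, where `N` has a single entry `4` on
the diagonal, comes with the multiplier `1`. -/
theorem exists_mem_thetaCover_lowerSp_single (k : Fin n) :
    ∃ g ∈ thetaCover n, g.elt = lowerSp (Matrix.single k k 4) (single_transpose k 4) ∧
      HasMultiplier g 1 := by
  set γ : Sp n := lowerSp (Matrix.single k k 4) (single_transpose k 4)
  let f : symMat n → ℂ := fun Z => (-Complex.I * (2 * Z.1 k k)) ^ (1 / 2 : ℂ) /
    (-Complex.I * (2 * Z.1 k k / (1 + 2 * (2 * Z.1 k k)))) ^ (1 / 2 : ℂ)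
  have him : ∀ Z ∈ siegelSpace n, 0 < (2 * Z.1 k k).im := fun Z hZ => by
    simpa [mat] using im_mat_apply_pos ⟨Z, hZ⟩ k
  have hne : ∀ Z ∈ siegelSpace n, 1 + 2 * (2 * Z.1 k k) ≠ 0 := fun Z hZ h => by
    have h1 := congrArg Complex.im h
    have h2 := him Z hZ
    simp at h1 h2
    exact h2.ne' h1
  have him' : ∀ Z ∈ siegelSpace n, 0 < (2 * Z.1 k k / (1 + 2 * (2 * Z.1 k k))).im :=
    fun Z hZ => by
      have h1 := him Z hZ
      have h2 := Complex.normSq_pos.mpr (hne Z hZ)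
      generalize 2 * Z.1 k k = σ at h1 h2 ⊢
      have h3 : (σ / (1 + 2 * σ)).im = σ.im / Complex.normSq (1 + 2 * σ) := by
        rw [Complex.div_im]
        simp
        ring
      rw [h3]
      positivity
  have hslit : ∀ z : ℂ, 0 < z.im → -Complex.I * z ∈ Complex.slitPlane := fun z hz => by
    left
    simpa using hz
  have hne0 : ∀ z : ℂ, 0 < z.im → (-Complex.I * z) ^ (1 / 2 : ℂ) ≠ 0 := fun z hz => by
    rw [Complex.cpow_ne_zero_iff]
    exact Or.inl (Complex.slitPlane_ne_zero (hslit z hz))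
  have han : AnalyticOnNhd ℂ f (siegelSpace n) := by
    have h1 : AnalyticOnNhd ℂ (fun Z : symMat n => 2 * Z.1 k k) (siegelSpace n) :=
      analyticOnNhd_const.mul (analyticOnNhd_apply k k _)
    have h2 : AnalyticOnNhd ℂ (fun Z : symMat n => 2 * Z.1 k k / (1 + 2 * (2 * Z.1 k k)))
        (siegelSpace n) :=
      h1.div (analyticOnNhd_const.add (analyticOnNhd_const.mul h1)) hne
    exact ((analyticOnNhd_const.mul h1).cpow analyticOnNhd_const fun Z hZ =>
      hslit _ (him Z hZ)).div ((analyticOnNhd_const.mul h2).cpow analyticOnNhd_const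
        fun Z hZ => hslit _ (him' Z hZ)) fun Z hZ => hne0 _ (him' Z hZ)
  have hf0 : ∀ τ : siegelSpace n, f τ.1 ≠ 0 := fun τ =>
    div_ne_zero (hne0 _ (him _ τ.2)) (hne0 _ (him' _ τ.2))
  let g : AutPair n := ⟨γ, fun τ => Units.mk0 (f τ.1) (hf0 τ)⟩
  have hmult : HasMultiplier g 1 := fun τ => by
    have h1 : 2 * τ.1.1 k k ≠ 0 := fun h => by
      have := him _ τ.2
      simp [h] at this
    have h2 := hne _ τ.2
    have h3 : (denom γ τ).det = 1 + ((4 : ℤ) : ℂ) * τ.1.1 k k := det_denom_lowerSp_single τ k 4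
    change (f τ.1) ^ 2 = 1 * (denom γ τ).det
    rw [div_pow, sq_cpow_half, sq_cpow_half, h3, mul_div_mul_left _ _ (by simp),
      div_div_cancel₀ h1]
    push_cast
    ring
  refine ⟨g, ⟨fun i j => ?_, ?_, fun τ => theta_lowerSp_single_smul τ k⟩, rfl, hmult⟩
  · change (4 : ℤ) ∣ Matrix.single k k 4 i j
    rw [Matrix.single_apply]
    split_ifs <;> simp
  · refine isAutomorphyFactor_of_analyticOnNhd f han (fun τ => rfl) fun τ => ?_
    rw [← norm_pow, hmult τ, one_mul]

/-! ### Multipliers of symmetric matrices in a one-fold cover -/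

theorem lowerSp_mul (N N' : Matrix (Fin n) (Fin n) ℤ) (hN : Nᵀ = N) (hN' : N'ᵀ = N') :
    lowerSp N hN * lowerSp N' hN' = lowerSp (N + N') (by rw [transpose_add, hN, hN']) := by
  apply Subtype.ext
  change fromBlocks 1 0 N 1 * fromBlocks 1 0 N' 1 = fromBlocks 1 0 (N + N') 1
  simp [fromBlocks_multiply]

theorem leviSp_mul_lowerSp (V W N : Matrix (Fin n) (Fin n) ℤ) (h : Vᵀ * W = 1) (hN : Nᵀ = N) :
    leviSp V W h * lowerSp N hN =
      lowerSp (W * N * Wᵀ) (by simp [hN, mul_assoc]) * leviSp V W h := by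
  have h' : Wᵀ * V = 1 := by
    have := congrArg transpose h
    simpa using this
  apply Subtype.ext
  change fromBlocks V 0 0 W * fromBlocks 1 0 N 1 =
    fromBlocks 1 0 (W * N * Wᵀ) 1 * fromBlocks V 0 0 W
  simp [fromBlocks_multiply, mul_assoc, h']

/-- The symmetric matrix `N` has multiplier `c` in `G` if `G` contains a pair with multiplier `c`
above `(1 0; N 1)`. -/
def LowerMultiplier (G : Subgroup (AutPair n)) (N : Matrix (Fin n) (Fin n) ℤ) (c : ℂ) : Prop :=
  ∃ hN : Nᵀ = N, ∃ g ∈ G, g.elt = lowerSp N hN ∧ HasMultiplier g c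

variable {Γ : Subgroup (Sp n)} {G : Subgroup (AutPair n)} {N N' : Matrix (Fin n) (Fin n) ℤ}
  {c c' : ℂ}

theorem LowerMultiplier.add (h : LowerMultiplier G N c) (h' : LowerMultiplier G N' c') :
    LowerMultiplier G (N + N') (c * c') := by
  obtain ⟨hN, g, hg, he, hm⟩ := h
  obtain ⟨hN', g', hg', he', hm'⟩ := h'
  refine ⟨by rw [transpose_add, hN, hN'], g * g', G.mul_mem hg hg', ?_, hm.mul hm'⟩
  rw [AutPair.mul_elt, he, he', lowerSp_mul]

theorem IsOneFoldCover.eq_of_elt_eq (hG : IsOneFoldCover Γ G) {g h : AutPair n} (hg : g ∈ G)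
    (hh : h ∈ G) (e : g.elt = h.elt) : g = h :=
  (hG.2 h.elt (hG.1 h hh).1).unique ⟨hg, e⟩ ⟨hh, rfl⟩

theorem IsOneFoldCover.exists_lowerMultiplier (hG : IsOneFoldCover Γ G) (hN : Nᵀ = N)
    (h : lowerSp N hN ∈ Γ) : ∃ c, LowerMultiplier G N c := by
  obtain ⟨g, ⟨hg, he⟩, -⟩ := hG.2 _ h
  obtain ⟨c, hc⟩ := (hG.1 g hg).2.exists_sq_eq
  exact ⟨c, hN, g, hg, he, hc⟩

theorem IsOneFoldCover.lowerMultiplier_unique (hG : IsOneFoldCover Γ G)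
    (h : LowerMultiplier G N c) (h' : LowerMultiplier G N c') : c = c' := by
  obtain ⟨hN, g, hg, he, hm⟩ := h
  obtain ⟨hN', g', hg', he', hm'⟩ := h'
  obtain rfl := hG.eq_of_elt_eq hg hg' (he.trans he'.symm)
  exact hm.unique hm'

theorem LowerMultiplier.ne_zero (h : LowerMultiplier G N c) : c ≠ 0 := by
  obtain ⟨-, g, -, -, hm⟩ := h
  exact hm.ne_zero

theorem LowerMultiplier.sub (hG : IsOneFoldCover Γ G) (h : LowerMultiplier G N c)
    (h' : LowerMultiplier G N' c') : LowerMultiplier G (N - N') (c / c') := by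
  obtain ⟨hN, g, hg, he, hm⟩ := h
  obtain ⟨hN', g', hg', he', hm'⟩ := h'
  have hs : (N - N')ᵀ = N - N' := by rw [transpose_sub, hN, hN']
  have hel : g.elt * g'.elt⁻¹ = lowerSp (N - N') hs := by
    rw [mul_inv_eq_iff_eq_mul, he, he', lowerSp_mul]
    simp
  have hmem := G.mul_mem hg (G.inv_mem hg')
  obtain ⟨d, hd⟩ := (hG.1 _ hmem).2.exists_sq_eq
  have hd' : HasMultiplier (g * g'⁻¹) d := hd
  have := (hd'.mul hm').unique (c := d * c') (d := c) (by rwa [inv_mul_cancel_right])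
  refine ⟨hs, g * g'⁻¹, hmem, hel, ?_⟩
  rwa [← this, mul_div_cancel_right₀ _ hm'.ne_zero]

/-- Conjugation by `(V 0; 0 W)` does not change multipliers. -/
theorem LowerMultiplier.conj (hG : IsOneFoldCover Γ G) (h0 : thetaCover n ⊆ G)
    (h : LowerMultiplier G N c) (V W : Matrix (Fin n) (Fin n) ℤ) (hVW : Vᵀ * W = 1) :
    LowerMultiplier G (W * N * Wᵀ) c := by
  obtain ⟨hN, g, hg, he, hm⟩ := h
  have hl := h0 (leviSp_mem_thetaCover V W hVW)
  set l : AutPair n := ⟨leviSp V W hVW, fun _ => 1⟩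
  obtain ⟨a, ha⟩ := (hG.1 l hl).2.exists_sq_eq
  have ha' : HasMultiplier l a := ha
  have hmem := G.mul_mem (G.mul_mem hl hg) (G.inv_mem hl)
  obtain ⟨d, hd⟩ := (hG.1 _ hmem).2.exists_sq_eq
  have hd' : HasMultiplier (l * g * l⁻¹) d := hd
  have := (hd'.mul ha').unique (c := d * a) (d := a * c)
    (by rw [inv_mul_cancel_right]; exact ha'.mul hm)
  have hdc : d = c := mul_right_cancel₀ ha'.ne_zero (this.trans (mul_comm a c))
  refine ⟨by simp [hN, mul_assoc], l * g * l⁻¹, hmem, ?_, hdc ▸ hd'⟩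
  change l.elt * g.elt * l.elt⁻¹ = _
  rw [mul_inv_eq_iff_eq_mul, he, leviSp_mul_lowerSp]

theorem lowerMultiplier_single (h0 : thetaCover n ⊆ G) (k : Fin n) :
    LowerMultiplier G (Matrix.single k k 4) 1 := by
  obtain ⟨g, hg, he, hm⟩ := exists_mem_thetaCover_lowerSp_single k
  exact ⟨_, g, h0 hg, he, hm⟩

/-! ### The elliptic element attached to a diagonal form -/

/-- The diagonal matrix with entries `1` at the indices in `s` and `0` elsewhere. -/
def indicatorDiag (s : Finset (Fin n)) : Matrix (Fin n) (Fin n) ℤ :=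
  diagonal fun i => if i ∈ s then 1 else 0

theorem indicatorDiag_transpose (s : Finset (Fin n)) :
    (indicatorDiag s)ᵀ = indicatorDiag s := diagonal_transpose _

theorem indicatorDiag_mul_self (s : Finset (Fin n)) :
    indicatorDiag s * indicatorDiag s = indicatorDiag s := by
  simp [indicatorDiag, diagonal_mul_diagonal]

/-- The point fixed by the elliptic element `(1 -D; 0 1) (1 0; 2 D 1)`. -/
def ellipticPoint (s : Finset (Fin n)) : siegelSpace n :=
  diagPoint (fun i => if i ∈ s then (-1 + Complex.I) / 2 else Complex.I) fun i => by
    split_ifs <;> simp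

theorem denom_ellipticPoint (s : Finset (Fin n))
    (h : (2 • indicatorDiag s)ᵀ = 2 • indicatorDiag s) :
    denom (lowerSp (2 • indicatorDiag s) h) (ellipticPoint s) =
      diagonal fun i => if i ∈ s then Complex.I else 1 := by
  rw [denom_lowerSp, ellipticPoint, mat_diagPoint, indicatorDiag, ← diagonal_smul,
    diagonal_map Int.cast_zero, diagonal_mul_diagonal, ← diagonal_one, diagonal_add]
  congr 1
  ext i
  by_cases hi : i ∈ s <;> simp [hi]
  ring

theorem elliptic_smul_ellipticPoint (s : Finset (Fin n))
    (h : (2 • indicatorDiag s)ᵀ = 2 • indicatorDiag s)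
    (h' : (-indicatorDiag s)ᵀ = -indicatorDiag s) :
    (upperSp (-indicatorDiag s) h' * lowerSp (2 • indicatorDiag s) h) • ellipticPoint s =
      ellipticPoint s := by
  have hD : (indicatorDiag s).map (Int.cast : ℤ → ℂ) =
      diagonal fun i => if i ∈ s then 1 else 0 := by
    rw [indicatorDiag, diagonal_map Int.cast_zero]
    congr 1
    ext i
    split_ifs <;> simp
  have hl : mat (lowerSp (2 • indicatorDiag s) h • ellipticPoint s) =
      mat (ellipticPoint s) + (indicatorDiag s).map (Int.cast : ℤ → ℂ) := by
    apply (isUnit_denom (lowerSp (2 • indicatorDiag s) h) (ellipticPoint s)).mul_right_cancel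
    rw [mat_smul_mul_denom, numer_lowerSp, denom_ellipticPoint, hD, ellipticPoint, mat_diagPoint,
      diagonal_add, diagonal_mul_diagonal]
    congr 1
    ext i
    by_cases hi : i ∈ s <;> simp [hi]
    linear_combination (-1 / 2 : ℂ) * Complex.I_sq
  apply mat_injective
  have hneg : (-indicatorDiag s).map (Int.cast : ℤ → ℂ) =
      -(indicatorDiag s).map (Int.cast : ℤ → ℂ) := by
    ext i j
    simp
  rw [mul_smul, mat_upperSp_smul, hl, hneg, add_neg_cancel_right]

theorem elliptic_sq (s : Finset (Fin n))
    (h : (2 • indicatorDiag s)ᵀ = 2 • indicatorDiag s)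
    (h' : (-indicatorDiag s)ᵀ = -indicatorDiag s)
    (h'' : (1 - 2 • indicatorDiag s)ᵀ * (1 - 2 • indicatorDiag s) = 1) :
    upperSp (-indicatorDiag s) h' * lowerSp (2 • indicatorDiag s) h *
      (upperSp (-indicatorDiag s) h' * lowerSp (2 • indicatorDiag s) h) =
      leviSp (1 - 2 • indicatorDiag s) (1 - 2 • indicatorDiag s) h'' := by
  apply Subtype.ext
  set D := indicatorDiag s with hD
  have hDD : D * D = D := indicatorDiag_mul_self s
  change fromBlocks 1 (-D) 0 1 * fromBlocks 1 0 (2 • D) 1 *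
    (fromBlocks 1 (-D) 0 1 * fromBlocks 1 0 (2 • D) 1) =
    fromBlocks (1 - 2 • D) 0 0 (1 - 2 • D)
  simp only [fromBlocks_multiply]
  simp only [one_mul, mul_one, mul_zero, zero_add, neg_mul, mul_neg,
    mul_smul_comm, smul_mul_assoc, hDD, mul_add, add_mul, fromBlocks_inj, smul_neg]
  refine ⟨?_, ?_, ?_, ?_⟩ <;> abel

/-- The square of the elliptic element `(1 -D; 0 1) (1 0; 2 D 1)` has theta factor `1`, and the
evaluation of its factor at the fixed point determines the multiplier of `2 D`. -/
theorem LowerMultiplier.mul_I_pow_card (hG : IsOneFoldCover Γ G) (h0 : thetaCover n ⊆ G)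
    {s : Finset (Fin n)} (h : LowerMultiplier G (2 • indicatorDiag s) c) :
    c * Complex.I ^ s.card = 1 := by
  obtain ⟨hN, g, hg, he, hm⟩ := h
  have h' : (-indicatorDiag s)ᵀ = -indicatorDiag s := by
    rw [transpose_neg, indicatorDiag_transpose]
  have h'' : (1 - 2 • indicatorDiag s : Matrix (Fin n) (Fin n) ℤ)ᵀ *
      (1 - 2 • indicatorDiag s) = 1 := by
    rw [transpose_sub, hN, transpose_one]
    simp only [sub_mul, mul_sub, one_mul, mul_one, smul_mul_assoc, mul_smul_comm,
      indicatorDiag_mul_self]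
    abel
  have ht := h0 (upperSp_mem_thetaCover _ h')
  have hl := h0 (leviSp_mem_thetaCover _ _ h'')
  set t : AutPair n := ⟨upperSp (-indicatorDiag s) h', fun _ => 1⟩
  have hu := G.mul_mem ht hg
  have hfix : (t * g).elt • ellipticPoint s = ellipticPoint s := by
    rw [AutPair.mul_elt, he]
    exact elliptic_smul_ellipticPoint s hN h'
  have hsq : t * g * (t * g) = _ := hG.eq_of_elt_eq (G.mul_mem hu hu) hl (by
    rw [AutPair.mul_elt, AutPair.mul_elt, he]
    exact elliptic_sq s hN h' h'')
  have hfac : (t * g).fac (ellipticPoint s) * (t * g).fac (ellipticPoint s) = 1 := by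
    have := congrArg (fun x => AutPair.fac x (ellipticPoint s)) hsq
    rwa [AutPair.mul_fac, hfix] at this
  have htg : (t * g).fac (ellipticPoint s) = g.fac (ellipticPoint s) := one_mul _
  rw [htg] at hfac
  have h1 := hm (ellipticPoint s)
  rw [sq, ← Units.val_mul, hfac, Units.val_one, he, denom_ellipticPoint, det_diagonal] at h1
  simpa [Finset.prod_ite] using h1.symm

/-! ### Multipliers of diagonal forms modulo 4 -/

theorem two_smul_indicatorDiag_apply (s : Finset (Fin n)) (i j : Fin n) :
    (2 • indicatorDiag s) i j = if i = j then (if i ∈ s then 2 else 0) else 0 := by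
  rw [Matrix.smul_apply, indicatorDiag, diagonal_apply]
  split_ifs <;> rfl

/-- For a single index `c² = 1`, by the theta transformation, while the fixed point gives
`c i = 1`. -/
theorem not_lowerSp_singleton (hG : IsOneFoldCover Γ G) (h0 : thetaCover n ⊆ G) (a : Fin n) {c : ℂ}
    (h : LowerMultiplier G (2 • indicatorDiag {a}) c) : False := by
  have h1 : c * Complex.I = 1 := by simpa using h.mul_I_pow_card hG h0
  have h2 : LowerMultiplier G (Matrix.single a a 4) (c * c) := by
    convert h.add h using 1
    ext i j
    rw [Matrix.add_apply, two_smul_indicatorDiag_apply, Matrix.single_apply]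
    grind
  have h3 : c * c = 1 := hG.lowerMultiplier_unique h2 (lowerMultiplier_single h0 a)
  -- Squaring `c i = 1` gives `c² = -1`.
  have h4 : (-1 : ℂ) = 1 := by
    linear_combination (c * Complex.I + 1) * h1 - c * c * Complex.I_sq + h3
  norm_num at h4

/-- If `2 D_s` has a multiplier at all, then `2 D_{a,b}` has multiplier `1`: a transvection sends
`2 D_s` to a form with the same multiplier, so the difference of the two has multiplier `1`. In the
variables `a` and `b` this difference is equivalent to `2 x² - 2 y²`, which differs from
`2 x² + 2 y²` by the form `4 y²` of multiplier `1`. -/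
theorem lowerMultiplier_pair (hG : IsOneFoldCover Γ G) (h0 : thetaCover n ⊆ G)
    {s : Finset (Fin n)} {a b : Fin n} (hab : a ≠ b) (hb : b ∈ s) {c : ℂ}
    (h : LowerMultiplier G (2 • indicatorDiag s) c) :
    LowerMultiplier G (2 • indicatorDiag {a, b}) 1 := by
  have hinv : ∀ {i j : Fin n}, i ≠ j → (1 - Matrix.single i j 1 : Matrix (Fin n) (Fin n) ℤ) *
      (1 + Matrix.single i j 1) = 1 := fun {i j} hij => by
    simp [sub_mul, mul_add, hij.symm]
  have h1 := h.conj hG h0 (1 - Matrix.single b a 1) (1 + Matrix.single a b 1)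
    (by simpa using hinv hab)
  have h2 := (h1.sub hG h).conj hG h0 (1 + Matrix.single a b 1) (1 - Matrix.single b a 1)
    (by rw [mul_eq_one_comm]; simpa using hinv hab.symm)
  have h3 := h2.add (lowerMultiplier_single h0 b)
  rw [div_self h.ne_zero, one_mul] at h3
  convert h3 using 1
  have hE : Matrix.single a b 1 * indicatorDiag s = Matrix.single a b 1 := by
    ext i j
    simp +contextual [indicatorDiag, mul_diagonal, Matrix.single_apply, ← ite_and]
    grind
  have hF : indicatorDiag s * Matrix.single b a 1 = Matrix.single b a 1 := by
    ext i j
    simp +contextual [indicatorDiag, diagonal_mul, Matrix.single_apply, ← ite_and]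
    grind
  have e1 : (1 + Matrix.single a b 1) * (2 • indicatorDiag s) *
      (1 + Matrix.single a b 1 : Matrix (Fin n) (Fin n) ℤ)ᵀ - 2 • indicatorDiag s =
      2 • (Matrix.single a b 1 + Matrix.single b a 1 + Matrix.single a a 1) := by
    rw [transpose_add, transpose_one, transpose_single, mul_smul_comm, smul_mul_assoc, ← smul_sub,
      add_mul, one_mul, hE, mul_add, mul_one, add_mul, hF, single_mul_single_same, mul_one]
    congr 1
    abel
  have e2 : (1 - Matrix.single b a 1 : Matrix (Fin n) (Fin n) ℤ) *
      (Matrix.single a b 1 + Matrix.single b a 1 + Matrix.single a a 1) *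
      (1 - Matrix.single a b 1) = Matrix.single a a 1 - Matrix.single b b 1 := by
    simp [sub_mul, mul_sub, mul_add, add_mul, hab, hab.symm]
    abel
  rw [e1, transpose_sub, transpose_one, transpose_single, mul_smul_comm, smul_mul_assoc, e2]
  ext i j
  rw [Matrix.add_apply, two_smul_indicatorDiag_apply, Matrix.smul_apply, Matrix.sub_apply,
    Matrix.single_apply, Matrix.single_apply, Matrix.single_apply]
  grind

/-- For two indices the fixed point gives `c i² = 1`, which excludes the multiplier `1` that
`lowerMultiplier_pair` provides. -/
theorem not_lowerSp_indicatorDiag (hG : IsOneFoldCover Γ G) (h0 : thetaCover n ⊆ G)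
    {s : Finset (Fin n)} (hs : s.Nonempty) (hN : (2 • indicatorDiag s)ᵀ = 2 • indicatorDiag s)
    (h : lowerSp (2 • indicatorDiag s) hN ∈ Γ) : False := by
  obtain ⟨c, hc⟩ := hG.exists_lowerMultiplier hN h
  rcases hs.exists_eq_singleton_or_nontrivial with ⟨a, rfl⟩ | ⟨a, -, b, hb, hab⟩
  · exact not_lowerSp_singleton hG h0 a hc
  · have := (lowerMultiplier_pair hG h0 hab hb hc).mul_I_pow_card hG h0
    rw [Finset.card_pair hab, one_mul, Complex.I_sq] at this
    norm_num at this

theorem lowerSp_mem_of_congr (hΓ : gammaZeroFour n ⊆ Γ) {N N' : Matrix (Fin n) (Fin n) ℤ}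
    (hN : Nᵀ = N) (hN' : N'ᵀ = N') (hc : CongrFour N N') (h : lowerSp N hN ∈ Γ) :
    lowerSp N' hN' ∈ Γ := by
  have hs : (N' - N)ᵀ = N' - N := by rw [transpose_sub, hN, hN']
  have hd : lowerSp (N' - N) hs ∈ Γ := hΓ fun i j => (hc i j).dvd
  have := Γ.mul_mem hd h
  rw [lowerSp_mul] at this
  simpa using this

theorem not_isOneFoldCover_of_lower (hΓ : gammaZeroFour n ⊆ Γ) (h0 : thetaCover n ⊆ G)
    {M : Matrix (Fin n) (Fin n) ℤ}
    (hM : ∃ γ ∈ Γ, (γ : Matrix (Fin n ⊕ Fin n) (Fin n ⊕ Fin n) ℤ) = fromBlocks 1 0 M 1)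
    (hshape : (∃ d d' : ℕ, d + d' ≤ n ∧ 0 < d + d' ∧ CongrFour M (shapePlus n d d')) ∨
      (∃ d e : ℕ, d + 2 * e ≤ n ∧ 0 < d ∧ CongrFour M (shapeMinus n d e))) :
    ¬ IsOneFoldCover Γ G := by
  intro hG
  obtain ⟨γ, hγ, hγM⟩ := hM
  have hMs : Mᵀ = M := by
    have := γ.2
    rw [hγM, SymplecticGroup.fromBlocks_mem_iff] at this
    simpa using this.1.symm
  have hL : lowerSp M hMs ∈ Γ := by
    convert hγ
    exact Subtype.ext hγM.symm
  have hL2 := Γ.mul_mem hL hL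
  rw [lowerSp_mul] at hL2
  have hD : ∀ s : Finset (Fin n), (2 • indicatorDiag s)ᵀ = 2 • indicatorDiag s := fun s => by
    rw [transpose_smul, indicatorDiag_transpose]
  have hent : ∀ (r : ℕ) (i j : Fin n),
      (2 • indicatorDiag (Finset.univ.filter fun i : Fin n => i.1 < r)) i j =
        if i = j then (if i.1 < r then 2 else 0) else 0 := fun r i j => by
    rw [two_smul_indicatorDiag_apply]
    simp
  have hne : ∀ r, 0 < r → r ≤ n → (Finset.univ.filter fun i : Fin n => i.1 < r).Nonempty :=
    fun r hr hrn => ⟨⟨0, by omega⟩, by simpa using hr⟩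
  -- The double of `M` is congruent to `2 I_d ⊥ 0` if `d > 0`; otherwise `M` itself is of this form.
  rcases hshape with ⟨d, d', hn, hpos, hc⟩ | ⟨d, e, hn, hpos, hc⟩
  · rcases Nat.eq_zero_or_pos d with rfl | hd
    · refine not_lowerSp_indicatorDiag hG h0 (hne d' (by omega) (by omega)) (hD _)
        (lowerSp_mem_of_congr hΓ hMs _ (fun i j => ?_) hL)
      rw [hent]
      have := hc i j
      by_cases hij : i = j
      · subst hij
        simpa [shapePlus] using this
      · simpa [shapePlus, hij] using this
    · refine not_lowerSp_indicatorDiag hG h0 (hne d hd (by omega)) (hD _)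
        (lowerSp_mem_of_congr hΓ _ _ (fun i j => ?_) hL2)
      rw [hent]
      have := (hc i j).add (hc i j)
      refine this.trans ?_
      by_cases hij : i = j
      · subst hij
        simp only [shapePlus, diagonal_apply_eq]
        split_ifs <;> rfl
      · simp [shapePlus, hij]
  · refine not_lowerSp_indicatorDiag hG h0 (hne d hpos (by omega)) (hD _)
      (lowerSp_mem_of_congr hΓ _ _ (fun i j => ?_) hL2)
    rw [hent]
    have := (hc i j).add (hc i j)
    refine this.trans ?_
    simp only [shapeMinus, Matrix.of_apply]
    split_ifs <;> rfl

/-! ### Degree one -/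

/-- The lower unipotent element `(1 0; m 1)` of `SL₂(ℤ)`. -/
def lowerSL (m : ℤ) : SL(2, ℤ) := ⟨!![1, 0; m, 1], by simp [det_fin_two]⟩

theorem slToSp_lowerSL (m : ℤ) :
    ((slToSp (lowerSL m) : Sp 1) : Matrix (Fin 1 ⊕ Fin 1) (Fin 1 ⊕ Fin 1) ℤ) =
      fromBlocks 1 0 !![m] 1 := by
  ext i j
  rcases i with i | i <;> rcases j with j | j <;> fin_cases i <;> fin_cases j <;> rfl

theorem gammaZeroFour_one_subset {Γ : Subgroup SL(2, ℤ)} (h : CongruenceSubgroup.Gamma0 4 ≤ Γ) :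
    gammaZeroFour 1 ⊆ (Γ.map slToSp.toMonoidHom : Subgroup (Sp 1)) := by
  intro γ hγ
  refine ⟨slToSp.symm γ, h ?_, slToSp.apply_symm_apply γ⟩
  rw [CongruenceSubgroup.Gamma0_mem]
  exact (ZMod.intCast_zmod_eq_zero_iff_dvd _ 4).mpr (hγ 0 0)

/-- A group strictly between `Γ₀(4)` and `SL₂(ℤ)` contains `(1 0; 1 1)` or `(1 0; 2 1)`. -/
theorem exists_lowerSL_mem {Γ : Subgroup SL(2, ℤ)} (h : CongruenceSubgroup.Gamma0 4 < Γ) :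
    lowerSL 1 ∈ Γ ∨ lowerSL 2 ∈ Γ := by
  obtain ⟨g, hg, hg0⟩ := SetLike.exists_of_lt h
  have hmem : ∀ x : SL(2, ℤ), (4 : ℤ) ∣ x.1 1 0 → x ∈ Γ := fun x hx => h.le (by
    rw [CongruenceSubgroup.Gamma0_mem]
    exact (ZMod.intCast_zmod_eq_zero_iff_dvd _ 4).mpr hx)
  rw [CongruenceSubgroup.Gamma0_mem] at hg0
  have hc : ¬ (4 : ℤ) ∣ g.1 1 0 := fun hx =>
    hg0 ((ZMod.intCast_zmod_eq_zero_iff_dvd _ 4).mpr hx)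
  have hdet := g.2
  rw [det_fin_two] at hdet
  set p := g.1 0 0
  set q := g.1 0 1
  set r := g.1 1 0 with hr
  set t := g.1 1 1 with ht
  -- `g (1 k; 0 1) = x (1 0; m 1)` with `x` in `Γ₀(4)`.
  have key : ∀ k m : ℤ, (4 : ℤ) ∣ r - m * (t + k * r) → lowerSL m ∈ Γ := by
    intro k m hk
    let T : SL(2, ℤ) := ⟨!![1, k; 0, 1], by simp [det_fin_two]⟩
    have hT : T ∈ Γ := hmem T (by simp [T])
    have hx : g * T * lowerSL (-m) ∈ Γ := hmem _ (by
      convert hk using 1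
      change (g.1 * !![1, k; 0, 1] * !![1, 0; -m, 1]) 1 0 = _
      simp [Matrix.mul_apply, Fin.sum_univ_two, ← hr, ← ht]
      ring)
    have hinv : lowerSL (-m) * lowerSL m = 1 := by
      apply Subtype.ext
      change !![1, 0; -m, 1] * !![1, 0; m, 1] = (1 : Matrix (Fin 2) (Fin 2) ℤ)
      ext i j
      fin_cases i <;> fin_cases j <;> simp
    have := Γ.mul_mem (Γ.inv_mem (Γ.mul_mem hg hT)) hx
    rw [inv_mul_cancel_left] at this
    rw [eq_inv_of_mul_eq_one_right hinv]
    exact Γ.inv_mem this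
  rcases Int.even_or_odd r with hev | hodd
  · -- Here `r ≡ 2` modulo `4`, and `t` is odd.
    right
    obtain ⟨x, hx⟩ := hev
    have htodd : Odd t := by
      by_contra hte
      obtain ⟨y, hy⟩ := Int.not_odd_iff_even.mp hte
      have : 2 * (p * y - q * x) = 1 := by rw [hx, hy] at hdet; linarith
      omega
    obtain ⟨y, hy⟩ := htodd
    refine key 0 2 ?_
    rw [zero_mul, add_zero]
    omega
  · -- Here `k` is chosen with `t + k r ≡ r` modulo `4`, using `r² ≡ 1` modulo `4`.
    left
    obtain ⟨x, hx⟩ := hodd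
    refine key (1 - t * r) 1 ⟨t * (x ^ 2 + x), ?_⟩
    rw [hx]
    ring

end SiegelTheta

end

theorem corollary3p7 :
    (∀ (n : ℕ) (Γ : Subgroup (SiegelTheta.Sp n)) (G : Subgroup (SiegelTheta.AutPair n)),
      SiegelTheta.gammaZeroFour n ⊆ Γ →
      SiegelTheta.IsCover Γ G →
      SiegelTheta.thetaCover n ⊆ G →
      ∀ M : Matrix (Fin n) (Fin n) ℤ,
        (∃ γ ∈ Γ, (γ : Matrix (Fin n ⊕ Fin n) (Fin n ⊕ Fin n) ℤ) = Matrix.fromBlocks 1 0 M 1) →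
        ((∃ d d' : ℕ, d + d' ≤ n ∧ 0 < d + d' ∧
            SiegelTheta.CongrFour M (SiegelTheta.shapePlus n d d')) ∨
          (∃ d e : ℕ, d + 2 * e ≤ n ∧ 0 < d ∧
            SiegelTheta.CongrFour M (SiegelTheta.shapeMinus n d e))) →
        ¬ SiegelTheta.IsOneFoldCover Γ G) ∧
    (¬ ∃ (Γ : Subgroup (Matrix.SpecialLinearGroup (Fin 2) ℤ))
        (G : Subgroup (SiegelTheta.AutPair 1)),
      CongruenceSubgroup.Gamma0 4 < Γ ∧
      SiegelTheta.thetaCover 1 ⊆ G ∧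
      SiegelTheta.IsOneFoldCover (Γ.map SiegelTheta.slToSp.toMonoidHom) G) := by
  refine ⟨fun n Γ G hΓ _ h0 M hM hs => SiegelTheta.not_isOneFoldCover_of_lower hΓ h0 hM hs, ?_⟩
  rintro ⟨Γ, G, hΓ, h0, hG⟩
  have hsub := SiegelTheta.gammaZeroFour_one_subset hΓ.le
  rcases SiegelTheta.exists_lowerSL_mem hΓ with h | h
  · refine SiegelTheta.not_isOneFoldCover_of_lower hsub h0
      ⟨_, ⟨_, h, rfl⟩, SiegelTheta.slToSp_lowerSL 1⟩
      (Or.inl ⟨1, 0, le_rfl, one_pos, fun i j => ?_⟩) hG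
    fin_cases i; fin_cases j; rfl
  · refine SiegelTheta.not_isOneFoldCover_of_lower hsub h0
      ⟨_, ⟨_, h, rfl⟩, SiegelTheta.slToSp_lowerSL 2⟩
      (Or.inl ⟨0, 1, le_rfl, one_pos, fun i j => ?_⟩) hG
    fin_cases i; fin_cases j; rfl
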